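/- Let $k$ be an algebraically closed field of characteristic zero, $G$ a finite group with identity $e$, and $\omega : G\times G\times G\to k^\times$ a normalized 3-cocycle. Let $D^\omega G$ be the twisted quantum double (Dijkgraaf–Pasquier–Roche quasi-Hopf algebra): it has basis $e_g\# x$ ($g,x\in G$), product $$(e_g\# x)(e_h\# y)=\delta_{g,xhx^{-1}}\,\theta_g(x,y)\,e_g\# xy,\qquad \theta_g(x,y)=\frac{\omega(g,x,y)\,\omega(x,y,(xy)^{-1}gxy)}{\omega(x,x^{-1}gx,y)},$$ coproduct $$\Delta(e_g\# x)=\sum_{st=g}\gamma_x(s,t)\,(e_s\# x)\otimes(e_t\# x),\qquad \gamma_x(s,t)=\frac{\omega(s,t,x)\,\omega(x,x^{-1}sx,x^{-1}tx)}{\omega(s,x,x^{-1}tx)},$$ counit $\epsilon(e_g\# x)=\delta_{g,e}$ and associator $\phi=\sum_{a,b,c}\omega(a,b,c)^{-1}\,(e_a\# e)\otimes (e_b\# e)\otimes (e_c\# e)$. The exponent $\exp D^\omega G$ is the smallest integer $N\ge 1$ such that $(\beta^2)^N$ is unipotent, where $\beta$ is the canonical braiding of the Drinfeld center $\mathcal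 Z(\operatorname{Rep} D^\omega G)$ of the category of finite-dimensional representations of $D^\omega G$, and $\beta^2=\beta_{V,U}\beta_{U,V}$. For $n\ge 1$ and $g \in G$ put $$\pi_{n,\omega}(g)=\prod_{j=1}^{n-1}\omega(g,g^j,g),$$ so that $\pi_{1,\omega}=1$. Then: (i) the exponent of $G$ divides $\exp D^\omega G$; (ii) $\exp D^\omega G$ is the smallest integer $n\ge 1$ such that $g^n=e$ for all $g\in G$ and $\pi_{n,\omega}$ is a character of $G$, i.e. a homomorphism $G\to k^\times$. -/

import Mathlib

open CategoryTheory MonoidalCategory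
open scoped TensorProduct

set_option linter.unusedSimpArgs false

universe u v

/-- A quasi-bialgebra over `k`: an algebra `H` with a comultiplication and a counit that are
algebra maps, and an invertible associator `φ ∈ H ⊗ H ⊗ H`. -/
class QuasiBialgebra (k : Type u) (H : Type v) [Field k] [Ring H] [Algebra k H] where
  /-- comultiplication -/
  Δ : H →ₐ[k] H ⊗[k] H
  /-- counit -/
  ε : H →ₐ[k] k
  /-- associator -/
  φ : (H ⊗[k] (H ⊗[k] H))ˣ
  counit_left : ∀ h : H, Algebra.TensorProduct.lid k H
    (Algebra.TensorProduct.map ε (AlgHom.id k H) (Δ h)) = h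
  counit_right : ∀ h : H, Algebra.TensorProduct.rid k k H
    (Algebra.TensorProduct.map (AlgHom.id k H) ε (Δ h)) = h
  /-- `(id ⊗ Δ)(Δ h) φ = φ (Δ ⊗ id)(Δ h)` -/
  quasi_coassoc : ∀ h : H,
    Algebra.TensorProduct.map (AlgHom.id k H) Δ (Δ h) * (φ : H ⊗[k] (H ⊗[k] H)) =
      (φ : H ⊗[k] (H ⊗[k] H)) * Algebra.TensorProduct.assoc k k k H H H
        (Algebra.TensorProduct.map Δ (AlgHom.id k H) (Δ h))
  /-- `(id ⊗ id ⊗ Δ)(φ) (Δ ⊗ id ⊗ id)(φ) = (1 ⊗ φ) (id ⊗ Δ ⊗ id)(φ) (φ ⊗ 1)` -/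
  pentagon :
    Algebra.TensorProduct.map (AlgHom.id k H) (Algebra.TensorProduct.map (AlgHom.id k H) Δ)
        (φ : H ⊗[k] (H ⊗[k] H)) *
      Algebra.TensorProduct.assoc k k k H H (H ⊗[k] H)
        (Algebra.TensorProduct.map Δ (AlgHom.id k (H ⊗[k] H)) (φ : H ⊗[k] (H ⊗[k] H))) =
    ((1 : H) ⊗ₜ[k] (φ : H ⊗[k] (H ⊗[k] H))) *
      Algebra.TensorProduct.map (AlgHom.id k H)
        ((Algebra.TensorProduct.assoc k k k H H H).toAlgHom.comp
          (Algebra.TensorProduct.map Δ (AlgHom.id k H))) (φ : H ⊗[k] (H ⊗[k] H)) *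
      Algebra.TensorProduct.map (AlgHom.id k H)
        (Algebra.TensorProduct.assoc k k k H H H).toAlgHom
        (Algebra.TensorProduct.assoc k k k H (H ⊗[k] H) H
          ((φ : H ⊗[k] (H ⊗[k] H)) ⊗ₜ[k] (1 : H)))
  /-- `(id ⊗ ε ⊗ id)(φ) = 1` -/
  counit_assoc : Algebra.TensorProduct.map (AlgHom.id k H)
    ((Algebra.TensorProduct.lid k H).toAlgHom.comp
      (Algebra.TensorProduct.map ε (AlgHom.id k H))) (φ : H ⊗[k] (H ⊗[k] H)) = 1

/-- A finite-dimensional representation of the `k`-algebra `H`. (Every finite-dimensional `k`-vector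
space is isomorphic to one in the universe of `k`, so no representation is lost.) -/
structure FDModule (k : Type u) (H : Type v) [Field k] [Ring H] [Algebra k H] where
  /-- underlying vector space -/
  V : Type u
  [addCommGroup : AddCommGroup V]
  [module : Module k V]
  [finite : FiniteDimensional k V]
  /-- the action of `H` -/
  ρ : H →ₐ[k] Module.End k V

namespace FDModule

attribute [instance] addCommGroup module finite

variable {k : Type u} {H : Type v} [Field k] [Ring H] [Algebra k H]

/-- An `H`-linear map. -/
@[ext]
structure Hom (X Y : FDModule k H) where
  /-- underlying linear map -/
  hom : X.V →ₗ[k] Y.V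
  comm : ∀ (h : H) (x : X.V), hom (X.ρ h x) = Y.ρ h (hom x)

instance : Category (FDModule k H) where
  Hom X Y := Hom X Y
  id X := ⟨LinearMap.id, fun _ _ => rfl⟩
  comp f g := ⟨g.hom ∘ₗ f.hom, fun h x => by simp [f.comm, g.comm]⟩

@[ext]
theorem hom_ext {X Y : FDModule k H} {f g : X ⟶ Y} (h : f.hom = g.hom) : f = g := Hom.ext h

@[simp]
theorem id_hom (X : FDModule k H) : (𝟙 X : X ⟶ X).hom = LinearMap.id := rfl

@[simp]
theorem comp_hom {X Y Z : FDModule k H} (f : X ⟶ Y) (g : Y ⟶ Z) :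
    (f ≫ g).hom = g.hom ∘ₗ f.hom := rfl

/-- An `H`-linear bijection is an isomorphism of representations. -/
def mkIso {X Y : FDModule k H} (e : X.V ≃ₗ[k] Y.V)
    (he : ∀ (h : H) (x : X.V), e (X.ρ h x) = Y.ρ h (e x)) : X ≅ Y where
  hom := ⟨e.toLinearMap, he⟩
  inv := ⟨e.symm.toLinearMap, fun h y => by
    apply e.injective
    simp [he]⟩
  hom_inv_id := by ext x; simp
  inv_hom_id := by ext x; simp

@[simp]
theorem mkIso_hom_hom {X Y : FDModule k H} (e : X.V ≃ₗ[k] Y.V)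
    (he : ∀ (h : H) (x : X.V), e (X.ρ h x) = Y.ρ h (e x)) :
    (mkIso e he).hom.hom = e.toLinearMap := rfl

/-- For actions of algebras `A` on `M` and `B` on `N`, the action of `A ⊗ B` on `M ⊗ N`. -/
noncomputable def tensorAct {A B M N : Type*} [Ring A] [Algebra k A] [Ring B] [Algebra k B]
    [AddCommGroup M] [Module k M] [AddCommGroup N] [Module k N]
    (f : A →ₐ[k] Module.End k M) (g : B →ₐ[k] Module.End k N) :
    A ⊗[k] B →ₐ[k] Module.End k (M ⊗[k] N) :=
  (Module.endTensorEndAlgHom (R := k) (S := k) (A := k)).comp (Algebra.TensorProduct.map f g)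

@[simp]
theorem tensorAct_tmul {A B M N : Type*} [Ring A] [Algebra k A] [Ring B] [Algebra k B]
    [AddCommGroup M] [Module k M] [AddCommGroup N] [Module k N]
    (f : A →ₐ[k] Module.End k M) (g : B →ₐ[k] Module.End k N) (a : A) (b : B) (m : M) (n : N) :
    tensorAct f g (a ⊗ₜ b) (m ⊗ₜ n) = f a m ⊗ₜ g b n := rfl

/-- A linear map of the form `p ⊗ q` intertwines the actions if `p` and `q` do. -/
theorem map_tensorAct {A B M N M' N' : Type*} [Ring A] [Algebra k A] [Ring B] [Algebra k B]
    [AddCommGroup M] [Module k M] [AddCommGroup N] [Module k N]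
    [AddCommGroup M'] [Module k M'] [AddCommGroup N'] [Module k N']
    {f : A →ₐ[k] Module.End k M} {g : B →ₐ[k] Module.End k N}
    {f' : A →ₐ[k] Module.End k M'} {g' : B →ₐ[k] Module.End k N'}
    (p : M →ₗ[k] M') (q : N →ₗ[k] N') (hp : ∀ a m, p (f a m) = f' a (p m))
    (hq : ∀ b n, q (g b n) = g' b (q n)) (t : A ⊗[k] B) (x : M ⊗[k] N) :
    TensorProduct.map p q (tensorAct f g t x) = tensorAct f' g' t (TensorProduct.map p q x) := by
  induction t with
  | zero => simp
  | add s t hs ht => simp [hs, ht]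
  | tmul a b =>
    induction x with
    | zero => simp
    | add x y hx hy => simp only [map_add, hx, hy]
    | tmul m n => simp [hp, hq]

/-- Pulling back the action of `A ⊗ B` along algebra maps `A' → A` and `B' → B`. -/
theorem tensorAct_comp {A B A' B' M N : Type*} [Ring A] [Algebra k A] [Ring B] [Algebra k B]
    [Ring A'] [Algebra k A'] [Ring B'] [Algebra k B']
    [AddCommGroup M] [Module k M] [AddCommGroup N] [Module k N]
    (f : A →ₐ[k] Module.End k M) (g : B →ₐ[k] Module.End k N)
    (a : A' →ₐ[k] A) (b : B' →ₐ[k] B) (t : A' ⊗[k] B') :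
    tensorAct (f.comp a) (g.comp b) t = tensorAct f g (Algebra.TensorProduct.map a b t) := by
  induction t with
  | zero => simp
  | add s t hs ht => simp [hs, ht]
  | tmul a b => ext; rfl

/-- The reassociation of a triple tensor product is compatible with the actions. -/
theorem assoc_tensorAct {A B C M N P : Type*} [Ring A] [Algebra k A] [Ring B] [Algebra k B]
    [Ring C] [Algebra k C] [AddCommGroup M] [Module k M] [AddCommGroup N] [Module k N]
    [AddCommGroup P] [Module k P]
    (f : A →ₐ[k] Module.End k M) (g : B →ₐ[k] Module.End k N) (h : C →ₐ[k] Module.End k P)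
    (t : (A ⊗[k] B) ⊗[k] C) (x : (M ⊗[k] N) ⊗[k] P) :
    TensorProduct.assoc k M N P (tensorAct (tensorAct f g) h t x) =
      tensorAct f (tensorAct g h) (Algebra.TensorProduct.assoc k k k A B C t)
        (TensorProduct.assoc k M N P x) := by
  induction t with
  | zero => simp
  | add s t hs ht => simp [hs, ht]
  | tmul s c =>
    induction s with
    | zero => simp
    | add s t hs ht => simp only [TensorProduct.add_tmul, map_add, LinearMap.add_apply, hs, ht]
    | tmul a b =>
      induction x with
      | zero => simp
      | add x y hx hy => simp only [map_add, hx, hy]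
      | tmul y p =>
        induction y with
        | zero => simp
        | add x y hx hy => simp only [TensorProduct.add_tmul, map_add, hx, hy]
        | tmul m n => rfl

variable [QuasiBialgebra k H]

open QuasiBialgebra

/-- The tensor product over `k`, with `H` acting through its comultiplication. -/
noncomputable def tensor (X Y : FDModule k H) : FDModule k H where
  V := X.V ⊗[k] Y.V
  ρ := (tensorAct X.ρ Y.ρ).comp Δ

variable (k H) in
/-- The action of `H` on `k` given by the counit. -/
noncomputable def unitAct : H →ₐ[k] Module.End k k :=
  (Algebra.lmul k k).comp ε

theorem unitAct_apply (h : H) (c : k) : unitAct k H h c = ε h * c := rfl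

/-- The trivial representation, given by the counit. -/
noncomputable def unit : FDModule k H where
  V := k
  ρ := unitAct k H

/-- The associativity constraint, given by the action of the associator `φ`. -/
noncomputable def associatorEquiv (X Y Z : FDModule k H) :
    (X.V ⊗[k] Y.V) ⊗[k] Z.V ≃ₗ[k] X.V ⊗[k] (Y.V ⊗[k] Z.V) :=
  (TensorProduct.assoc k X.V Y.V Z.V).trans
    (LinearMap.GeneralLinearGroup.generalLinearEquiv k _
      (Units.map (tensorAct X.ρ (tensorAct Y.ρ Z.ρ)).toMonoidHom φ))

theorem associatorEquiv_apply (X Y Z : FDModule k H) (x : (X.V ⊗[k] Y.V) ⊗[k] Z.V) :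
    associatorEquiv X Y Z x = tensorAct X.ρ (tensorAct Y.ρ Z.ρ) (φ : (H ⊗[k] (H ⊗[k] H))ˣ).val
      (TensorProduct.assoc k X.V Y.V Z.V x) := rfl

theorem associatorEquiv_comm (X Y Z : FDModule k H) (h : H) (x : (X.V ⊗[k] Y.V) ⊗[k] Z.V) :
    associatorEquiv X Y Z ((tensor (tensor X Y) Z).ρ h x) =
      (tensor X (tensor Y Z)).ρ h (associatorEquiv X Y Z x) := by
  have e1 : (tensor (tensor X Y) Z).ρ h =
      tensorAct (tensorAct X.ρ Y.ρ) Z.ρ (Algebra.TensorProduct.map Δ (AlgHom.id k H) (Δ h)) := by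
    rw [← tensorAct_comp]; rfl
  have e2 : (tensor X (tensor Y Z)).ρ h =
      tensorAct X.ρ (tensorAct Y.ρ Z.ρ) (Algebra.TensorProduct.map (AlgHom.id k H) Δ (Δ h)) := by
    rw [← tensorAct_comp]; rfl
  rw [e1, e2]
  change tensorAct X.ρ (tensorAct Y.ρ Z.ρ) (φ : (H ⊗[k] (H ⊗[k] H))ˣ).val
      (TensorProduct.assoc k X.V Y.V Z.V (tensorAct (tensorAct X.ρ Y.ρ) Z.ρ _ x)) =
    tensorAct X.ρ (tensorAct Y.ρ Z.ρ) _ (tensorAct X.ρ (tensorAct Y.ρ Z.ρ)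
      (φ : (H ⊗[k] (H ⊗[k] H))ˣ).val (TensorProduct.assoc k X.V Y.V Z.V x))
  rw [assoc_tensorAct, ← Module.End.mul_apply, ← Module.End.mul_apply, ← map_mul, ← map_mul,
    quasi_coassoc]

theorem lid_comm (X : FDModule k H) (h : H) (x : k ⊗[k] X.V) :
    TensorProduct.lid k X.V ((tensor unit X).ρ h x) = X.ρ h (TensorProduct.lid k X.V x) := by
  have key : ∀ t : H ⊗[k] H, TensorProduct.lid k X.V (tensorAct (unitAct k H) X.ρ t x) =
      X.ρ (Algebra.TensorProduct.lid k H (Algebra.TensorProduct.map ε (AlgHom.id k H) t))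
        (TensorProduct.lid k X.V x) := by
    intro t
    induction t with
    | zero => simp
    | add s t hs ht => simp [hs, ht]
    | tmul a b =>
      induction x with
      | zero => simp
      | add x y hx hy => simp only [map_add, hx, hy]
      | tmul c y =>
        simp only [tensorAct_tmul, unitAct_apply, TensorProduct.lid_tmul, TensorProduct.rid_tmul,
          Algebra.TensorProduct.map_tmul, Algebra.TensorProduct.lid_tmul, AlgHom.comp_apply,
          Algebra.TensorProduct.rid_tmul, map_smul, LinearMap.smul_apply, AlgHom.coe_id, id_eq,
          mul_smul, LinearEquiv.coe_coe, AlgEquiv.toAlgHom_apply]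
        exact smul_comm _ _ _
  exact (key (Δ h)).trans (by rw [counit_left])

theorem rid_comm (X : FDModule k H) (h : H) (x : X.V ⊗[k] k) :
    TensorProduct.rid k X.V ((tensor X unit).ρ h x) = X.ρ h (TensorProduct.rid k X.V x) := by
  have key : ∀ t : H ⊗[k] H, TensorProduct.rid k X.V (tensorAct X.ρ (unitAct k H) t x) =
      X.ρ (Algebra.TensorProduct.rid k k H (Algebra.TensorProduct.map (AlgHom.id k H) ε t))
        (TensorProduct.rid k X.V x) := by
    intro t
    induction t with
    | zero => simp
    | add s t hs ht => simp [hs, ht]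
    | tmul a b =>
      induction x with
      | zero => simp
      | add x y hx hy => simp only [map_add, hx, hy]
      | tmul y c =>
        simp only [tensorAct_tmul, unitAct_apply, TensorProduct.lid_tmul, TensorProduct.rid_tmul,
          Algebra.TensorProduct.map_tmul, Algebra.TensorProduct.lid_tmul, AlgHom.comp_apply,
          Algebra.TensorProduct.rid_tmul, map_smul, LinearMap.smul_apply, AlgHom.coe_id, id_eq,
          mul_smul, LinearEquiv.coe_coe, AlgEquiv.toAlgHom_apply]
        exact smul_comm _ _ _
  exact (key (Δ h)).trans (by rw [counit_right])

/-- The tensor product, unit and constraints of `Rep H`. -/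
noncomputable instance : MonoidalCategoryStruct (FDModule k H) where
  tensorObj := tensor
  tensorUnit := unit
  tensorHom f g := ⟨TensorProduct.map f.hom g.hom,
    fun h x => map_tensorAct f.hom g.hom f.comm g.comm (Δ h) x⟩
  whiskerLeft _ _ _ f := ⟨TensorProduct.map LinearMap.id f.hom,
    fun h x => map_tensorAct LinearMap.id f.hom (fun _ _ => rfl) f.comm (Δ h) x⟩
  whiskerRight f _ := ⟨TensorProduct.map f.hom LinearMap.id,
    fun h x => map_tensorAct f.hom LinearMap.id f.comm (fun _ _ => rfl) (Δ h) x⟩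
  associator X Y Z := mkIso (associatorEquiv X Y Z) (associatorEquiv_comm X Y Z)
  leftUnitor X := mkIso (TensorProduct.lid k X.V) (lid_comm X)
  rightUnitor X := mkIso (TensorProduct.rid k X.V) (rid_comm X)

theorem associator_naturality_aux {X₁ X₂ X₃ Y₁ Y₂ Y₃ : FDModule k H}
    (f₁ : X₁ ⟶ Y₁) (f₂ : X₂ ⟶ Y₂) (f₃ : X₃ ⟶ Y₃) :
    ((f₁ ⊗ₘ f₂) ⊗ₘ f₃) ≫ (α_ Y₁ Y₂ Y₃).hom = (α_ X₁ X₂ X₃).hom ≫ (f₁ ⊗ₘ (f₂ ⊗ₘ f₃)) := by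
  apply hom_ext
  apply LinearMap.ext
  intro x
  change tensorAct Y₁.ρ (tensorAct Y₂.ρ Y₃.ρ) (φ : (H ⊗[k] (H ⊗[k] H))ˣ).val
      (TensorProduct.assoc k _ _ _ (TensorProduct.map (TensorProduct.map f₁.hom f₂.hom) f₃.hom x)) =
    TensorProduct.map f₁.hom (TensorProduct.map f₂.hom f₃.hom)
      (tensorAct X₁.ρ (tensorAct X₂.ρ X₃.ρ) (φ : (H ⊗[k] (H ⊗[k] H))ˣ).val
        (TensorProduct.assoc k _ _ _ x))
  rw [map_tensorAct _ _ f₁.comm (map_tensorAct _ _ f₂.comm f₃.comm)]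
  congr 1
  exact LinearMap.congr_fun (TensorProduct.map_map_comp_assoc_eq f₁.hom f₂.hom f₃.hom).symm x

theorem triangle_lin (M N : Type*) [AddCommGroup M] [Module k M] [AddCommGroup N] [Module k N] :
    TensorProduct.map LinearMap.id (TensorProduct.lid k N).toLinearMap ∘ₗ
        (TensorProduct.assoc k M k N).toLinearMap =
      TensorProduct.map (TensorProduct.rid k M).toLinearMap LinearMap.id := by
  ext m n
  simp

theorem triangle_aux (X Y : FDModule k H) :
    (α_ X (𝟙_ (FDModule k H)) Y).hom ≫ (𝟙 X ⊗ₘ (λ_ Y).hom) = (ρ_ X).hom ⊗ₘ 𝟙 Y := by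
  apply hom_ext
  apply LinearMap.ext
  intro x
  change TensorProduct.map LinearMap.id (TensorProduct.lid k Y.V).toLinearMap
      (tensorAct X.ρ (tensorAct (unitAct k H) Y.ρ) (φ : (H ⊗[k] (H ⊗[k] H))ˣ).val
        (TensorProduct.assoc k _ _ _ x)) =
    TensorProduct.map (TensorProduct.rid k X.V).toLinearMap LinearMap.id x
  have key : ∀ (t : H ⊗[k] (H ⊗[k] H)) (y : X.V ⊗[k] (k ⊗[k] Y.V)),
      TensorProduct.map LinearMap.id (TensorProduct.lid k Y.V).toLinearMap
        (tensorAct X.ρ (tensorAct (unitAct k H) Y.ρ) t y) =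
      tensorAct X.ρ Y.ρ (Algebra.TensorProduct.map (AlgHom.id k H)
        ((Algebra.TensorProduct.lid k H).toAlgHom.comp
          (Algebra.TensorProduct.map ε (AlgHom.id k H))) t)
        (TensorProduct.map LinearMap.id (TensorProduct.lid k Y.V).toLinearMap y) := by
    intro t y
    rw [← tensorAct_comp]
    refine map_tensorAct _ _ (fun _ _ => rfl) (fun s z => ?_) t y
    induction s with
    | zero => simp
    | add s t hs ht =>
      simp only [map_add, LinearMap.add_apply]
      rw [hs, ht]
    | tmul a b =>
      induction z with
      | zero => simp
      | add x y hx hy => simp only [map_add, hx, hy]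
      | tmul c y =>
        simp only [tensorAct_tmul, unitAct_apply, TensorProduct.lid_tmul, TensorProduct.rid_tmul,
          Algebra.TensorProduct.map_tmul, Algebra.TensorProduct.lid_tmul, AlgHom.comp_apply,
          Algebra.TensorProduct.rid_tmul, map_smul, LinearMap.smul_apply, AlgHom.coe_id, id_eq,
          mul_smul, LinearEquiv.coe_coe, AlgEquiv.toAlgHom_apply]
        exact smul_comm _ _ _
  rw [key, counit_assoc, map_one, Module.End.one_apply]
  exact LinearMap.congr_fun (triangle_lin (k := k) X.V Y.V) x

theorem pentagon_lin {M N P Q : Type*} [AddCommGroup M] [Module k M] [AddCommGroup N] [Module k N]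
    [AddCommGroup P] [Module k P] [AddCommGroup Q] [Module k Q]
    (a : H →ₐ[k] Module.End k M) (b : H →ₐ[k] Module.End k N) (c : H →ₐ[k] Module.End k P)
    (d : H →ₐ[k] Module.End k Q) (x : ((M ⊗[k] N) ⊗[k] P) ⊗[k] Q) :
    TensorProduct.map LinearMap.id
        (tensorAct b (tensorAct c d) (φ : (H ⊗[k] (H ⊗[k] H))ˣ).val ∘ₗ
          (TensorProduct.assoc k N P Q).toLinearMap)
        (tensorAct a (tensorAct ((tensorAct b c).comp Δ) d) (φ : (H ⊗[k] (H ⊗[k] H))ˣ).val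
          (TensorProduct.assoc k M (N ⊗[k] P) Q (TensorProduct.map
            (tensorAct a (tensorAct b c) (φ : (H ⊗[k] (H ⊗[k] H))ˣ).val ∘ₗ
              (TensorProduct.assoc k M N P).toLinearMap) LinearMap.id x))) =
      tensorAct a (tensorAct b ((tensorAct c d).comp Δ)) (φ : (H ⊗[k] (H ⊗[k] H))ˣ).val
        (TensorProduct.assoc k M N (P ⊗[k] Q)
          (tensorAct ((tensorAct a b).comp Δ) (tensorAct c d) (φ : (H ⊗[k] (H ⊗[k] H))ˣ).val
            (TensorProduct.assoc k (M ⊗[k] N) P Q x))) := by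
  set f := (φ : (H ⊗[k] (H ⊗[k] H))ˣ).val with hf
  have h1 : ∀ y, TensorProduct.map LinearMap.id
      (tensorAct b (tensorAct c d) f ∘ₗ (TensorProduct.assoc k N P Q).toLinearMap) y =
      tensorAct a (tensorAct b (tensorAct c d)) ((1 : H) ⊗ₜ f)
        (TensorProduct.map LinearMap.id (TensorProduct.assoc k N P Q).toLinearMap y) := by
    intro y
    induction y with
    | zero => simp only [map_zero]
    | add x y hx hy => simp only [map_add, hx, hy]
    | tmul m n => simp
  have h2 : ∀ s y, TensorProduct.map LinearMap.id (TensorProduct.assoc k N P Q).toLinearMap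
      (tensorAct a (tensorAct (tensorAct b c) d) s y) =
      tensorAct a (tensorAct b (tensorAct c d)) (Algebra.TensorProduct.map (AlgHom.id k H)
        (Algebra.TensorProduct.assoc k k k H H H).toAlgHom s)
        (TensorProduct.map LinearMap.id (TensorProduct.assoc k N P Q).toLinearMap y) := by
    intro s y
    rw [← tensorAct_comp]
    exact map_tensorAct _ _ (fun _ _ => rfl) (fun t z => assoc_tensorAct b c d t z) s y
  have h3 : ∀ y, TensorProduct.map (tensorAct a (tensorAct b c) f ∘ₗ
      (TensorProduct.assoc k M N P).toLinearMap) LinearMap.id y =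
      tensorAct (tensorAct a (tensorAct b c)) d (f ⊗ₜ (1 : H))
        (TensorProduct.map (TensorProduct.assoc k M N P).toLinearMap LinearMap.id y) := by
    intro y
    induction y with
    | zero => simp only [map_zero]
    | add x y hx hy => simp only [map_add, hx, hy]
    | tmul m n => simp
  have h4 : ∀ s, tensorAct a (tensorAct ((tensorAct b c).comp Δ) d) s =
      tensorAct a (tensorAct (tensorAct b c) d)
        (Algebra.TensorProduct.map (AlgHom.id k H)
          (Algebra.TensorProduct.map Δ (AlgHom.id k H)) s) := by
    intro s
    rw [← tensorAct_comp]
    congr 2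
    exact AlgHom.ext (tensorAct_comp (tensorAct b c) d Δ (AlgHom.id k H))
  have h5 : ∀ s, tensorAct a (tensorAct b ((tensorAct c d).comp Δ)) s =
      tensorAct a (tensorAct b (tensorAct c d))
        (Algebra.TensorProduct.map (AlgHom.id k H)
          (Algebra.TensorProduct.map (AlgHom.id k H) Δ) s) := by
    intro s
    rw [← tensorAct_comp]
    congr 2
    exact AlgHom.ext (tensorAct_comp b (tensorAct c d) (AlgHom.id k H) Δ)
  have h6 : ∀ s, tensorAct ((tensorAct a b).comp Δ) (tensorAct c d) s =
      tensorAct (tensorAct a b) (tensorAct c d)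
        (Algebra.TensorProduct.map Δ (AlgHom.id k (H ⊗[k] H)) s) := by
    intro s
    rw [← tensorAct_comp]
    rfl
  have h7 : TensorProduct.map LinearMap.id (TensorProduct.assoc k N P Q).toLinearMap
      (TensorProduct.assoc k M (N ⊗[k] P) Q
        (TensorProduct.map (TensorProduct.assoc k M N P).toLinearMap LinearMap.id x)) =
      TensorProduct.assoc k M N (P ⊗[k] Q) (TensorProduct.assoc k (M ⊗[k] N) P Q x) := by
    have : TensorProduct.map LinearMap.id (TensorProduct.assoc k N P Q).toLinearMap ∘ₗ
        (TensorProduct.assoc k M (N ⊗[k] P) Q).toLinearMap ∘ₗ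
        TensorProduct.map (TensorProduct.assoc k M N P).toLinearMap LinearMap.id =
        (TensorProduct.assoc k M N (P ⊗[k] Q)).toLinearMap ∘ₗ
          (TensorProduct.assoc k (M ⊗[k] N) P Q).toLinearMap := by
      ext m n p q
      rfl
    exact LinearMap.congr_fun this x
  have h8 : ∀ s, Algebra.TensorProduct.map (AlgHom.id k H)
      (Algebra.TensorProduct.assoc k k k H H H).toAlgHom (Algebra.TensorProduct.map (AlgHom.id k H)
        (Algebra.TensorProduct.map Δ (AlgHom.id k H)) s) =
      Algebra.TensorProduct.map (AlgHom.id k H)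
        ((Algebra.TensorProduct.assoc k k k H H H).toAlgHom.comp
          (Algebra.TensorProduct.map Δ (AlgHom.id k H))) s := by
    intro s
    induction s with
    | zero => simp only [map_zero]
    | add x y hx hy => simp only [map_add, hx, hy]
    | tmul m n => rfl
  rw [h1, h4, h2, h3, assoc_tensorAct, h2, h5, h6, assoc_tensorAct, h7, h8]
  simp only [← Module.End.mul_apply]
  rw [← map_mul, ← map_mul, ← map_mul, hf, QuasiBialgebra.pentagon]
  exact congrArg (fun s => tensorAct a (tensorAct b (tensorAct c d)) s _) (mul_assoc _ _ _).symm

theorem pentagon_aux (W X Y Z : FDModule k H) :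
    ((α_ W X Y).hom ⊗ₘ 𝟙 Z) ≫ (α_ W (X ⊗ Y) Z).hom ≫ (𝟙 W ⊗ₘ (α_ X Y Z).hom) =
      (α_ (W ⊗ X) Y Z).hom ≫ (α_ W X (Y ⊗ Z)).hom := by
  apply hom_ext
  apply LinearMap.ext
  intro x
  exact pentagon_lin W.ρ X.ρ Y.ρ Z.ρ x

/-- The monoidal category `Rep H` of finite-dimensional representations of `H`. -/
noncomputable instance : MonoidalCategory (FDModule k H) :=
  MonoidalCategory.ofTensorHom
    (id_tensorHom_id := fun X Y => hom_ext TensorProduct.map_id)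
    (id_tensorHom := fun _ _ _ _ => rfl)
    (tensorHom_id := fun _ _ => rfl)
    (tensorHom_comp_tensorHom := fun f₁ f₂ g₁ g₂ =>
      hom_ext (TensorProduct.map_comp g₁.hom g₂.hom f₁.hom f₂.hom).symm)
    (associator_naturality := associator_naturality_aux)
    (leftUnitor_naturality := fun f => by
      apply hom_ext
      apply TensorProduct.ext'
      intro c x
      exact (f.hom.map_smul (c : k) x).symm)
    (rightUnitor_naturality := fun f => by
      apply hom_ext
      apply TensorProduct.ext'
      intro x c
      exact (f.hom.map_smul (c : k) x).symm)
    (pentagon := pentagon_aux)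
    (triangle := triangle_aux)

end FDModule

/-- The double braiding `β_{Y,X} β_{X,Y}` of two objects of the Drinfeld center of `Rep H`, as a linear
endomorphism of the underlying vector space of `X ⊗ Y`. -/
noncomputable def doubleBraiding {k : Type u} {H : Type v} [Field k] [Ring H] [Algebra k H]
    [QuasiBialgebra k H] (X Y : Center (FDModule k H)) :
    Module.End k (X ⊗ Y).1.V :=
  ((β_ X Y).hom ≫ (β_ Y X).hom).f.hom

/-- The (quasi-)exponent of `H`: the smallest `N ≥ 1` such that the `N`-th power of the squared
canonical braiding `β²` is unipotent in the Drinfeld center of the category of finite-dimensional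
representations of `H`. When `Rep H` is a fusion category this is called the exponent of `H`. -/
noncomputable def quasiExponent (k : Type u) (H : Type v) [Field k] [Ring H] [Algebra k H]
    [QuasiBialgebra k H] : ℕ :=
  sInf {N : ℕ | 0 < N ∧ ∀ X Y : Center (FDModule k H), IsNilpotent (doubleBraiding X Y ^ N - 1)}

/-- A normalized 3-cocycle on the group `G` with values in `kˣ` (trivial action). -/
structure NormalizedThreeCocycle (G : Type v) (k : Type u) [Group G] [Field k] where
  /-- the underlying function -/
  toFun : G → G → G → kˣ
  cocycle : ∀ x y z w : G, toFun y z w * toFun x (y * z) w * toFun x y z =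
    toFun (x * y) z w * toFun x y (z * w)
  map_one_left : ∀ x y : G, toFun 1 x y = 1
  map_one_mid : ∀ x y : G, toFun x 1 y = 1
  map_one_right : ∀ x y : G, toFun x y 1 = 1

namespace NormalizedThreeCocycle

variable {G : Type v} {k : Type u} [Group G] [Field k]

instance : CoeFun (NormalizedThreeCocycle G k) (fun _ => G → G → G → kˣ) := ⟨toFun⟩

/-- `θ_g(x, y) = ω(g, x, y) ω(x, y, (xy)⁻¹ g (xy)) / ω(x, x⁻¹ g x, y)` -/
def θ (ω : NormalizedThreeCocycle G k) (g x y : G) : kˣ :=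
  ω g x y * ω x y ((x * y)⁻¹ * g * (x * y)) / ω x (x⁻¹ * g * x) y

/-- `γ_g(x, y) = ω(x, y, g) ω(g, g⁻¹ x g, g⁻¹ y g) / ω(x, g, g⁻¹ y g)` -/
def γ (ω : NormalizedThreeCocycle G k) (g x y : G) : kˣ :=
  ω x y g * ω g (g⁻¹ * x * g) (g⁻¹ * y * g) / ω x g (g⁻¹ * y * g)

variable (ω : NormalizedThreeCocycle G k)

theorem θ_one_right (g x : G) : ω.θ g x 1 = 1 := by
  simp [θ, map_one_right, map_one_mid]

theorem θ_one_left (g y : G) : ω.θ g 1 y = 1 := by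
  simp [θ, map_one_left, map_one_mid]

theorem γ_one (x y : G) : ω.γ 1 x y = 1 := by
  simp [γ, map_one_left, map_one_mid, map_one_right]

theorem γ_one_left (g y : G) : ω.γ g 1 y = 1 := by
  simp [γ, map_one_left, map_one_mid]

theorem γ_one_right (g x : G) : ω.γ g x 1 = 1 := by
  simp [γ, map_one_right, map_one_mid]

theorem cocycle_add (x y z w : G) : Additive.ofMul (ω y z w) + Additive.ofMul (ω x (y * z) w) +
    Additive.ofMul (ω x y z) = Additive.ofMul (ω (x * y) z w) + Additive.ofMul (ω x y (z * w)) :=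
  congrArg Additive.ofMul (ω.cocycle x y z w)

theorem θ_cocycle (g x y z : G) :
    ω.θ g x y * ω.θ g (x * y) z = ω.θ g x (y * z) * ω.θ (x⁻¹ * g * x) y z := by
  have h1 := ω.cocycle_add g x y z
  have h2 := ω.cocycle_add x (x⁻¹ * g * x) y z
  have h3 := ω.cocycle_add x y ((x * y)⁻¹ * g * (x * y)) z
  have h4 := ω.cocycle_add x y z ((x * y * z)⁻¹ * g * (x * y * z))
  apply Additive.ofMul.injective
  simp only [θ, ofMul_mul, ofMul_div]
  simp only [mul_assoc, mul_inv_rev, mul_inv_cancel_left, inv_mul_cancel_left] at h1 h2 h3 h4 ⊢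
  grind

theorem γ_mul (x y s t : G) :
    ω.γ x s t * ω.γ y (x⁻¹ * s * x) (x⁻¹ * t * x) * ω.θ s x y * ω.θ t x y =
      ω.θ (s * t) x y * ω.γ (x * y) s t := by
  have h1 := ω.cocycle_add s t x y
  have h2 := ω.cocycle_add s x (x⁻¹ * t * x) y
  have h3 := ω.cocycle_add x (x⁻¹ * s * x) (x⁻¹ * t * x) y
  have h4 := ω.cocycle_add s x y ((x * y)⁻¹ * t * (x * y))
  have h5 := ω.cocycle_add x (x⁻¹ * s * x) y ((x * y)⁻¹ * t * (x * y))
  have h6 := ω.cocycle_add x y ((x * y)⁻¹ * s * (x * y)) ((x * y)⁻¹ * t * (x * y))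
  apply Additive.ofMul.injective
  simp only [θ, γ, ofMul_mul, ofMul_div]
  simp only [mul_assoc, mul_inv_rev, mul_inv_cancel_left, inv_mul_cancel_left]
    at h1 h2 h3 h4 h5 h6 ⊢
  grind

theorem γ_coassoc (x a b c : G) :
    ω.γ x a (b * c) * ω.γ x b c * (ω (x⁻¹ * a * x) (x⁻¹ * b * x) (x⁻¹ * c * x))⁻¹ =
      (ω a b c)⁻¹ * (ω.γ x (a * b) c * ω.γ x a b) := by
  have h1 := ω.cocycle_add a b c x
  have h2 := ω.cocycle_add a b x (x⁻¹ * c * x)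
  have h3 := ω.cocycle_add a x (x⁻¹ * b * x) (x⁻¹ * c * x)
  have h4 := ω.cocycle_add x (x⁻¹ * a * x) (x⁻¹ * b * x) (x⁻¹ * c * x)
  apply Additive.ofMul.injective
  simp only [γ, ofMul_mul, ofMul_div, ofMul_inv]
  simp only [mul_assoc, mul_inv_rev, mul_inv_cancel_left, inv_mul_cancel_left] at h1 h2 h3 h4 ⊢
  grind

/-- `π_{n,ω}(g) = ∏_{j=1}^{n-1} ω(g, g^j, g)`; in particular `π_{1,ω} = 1`. -/
def piMap (n : ℕ) (g : G) : kˣ :=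
  ∏ j ∈ Finset.Ico 1 n, ω g (g ^ j) g

end NormalizedThreeCocycle

/-- The underlying vector space `k^G ⊗ kG` of the twisted quantum double `D^ω G`: the function
with value `c (g, x)` at `(g, x)` stands for `∑ c (g, x) e_g # x`. -/
def TwistedDouble {G : Type v} {k : Type u} [Group G] [Field k]
    (_ω : NormalizedThreeCocycle G k) : Type (max u v) := G × G → k

namespace TwistedDouble

variable {G : Type v} {k : Type u} [Group G] [Field k] (ω : NormalizedThreeCocycle G k)

section Structure

/-- Pointwise addition. -/
abbrev addCommGroup : AddCommGroup (TwistedDouble ω) := inferInstanceAs (AddCommGroup (G × G → k))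

attribute [local instance] addCommGroup

/-- Pointwise scalar multiplication. -/
abbrev module : Module k (TwistedDouble ω) := inferInstanceAs (Module k (G × G → k))

attribute [local instance] module

variable [Fintype G]

/-- The basis of the elements `e_g # x`. -/
noncomputable def basis : Module.Basis (G × G) k (TwistedDouble ω) := Pi.basisFun k (G × G)

/-- The element `e_g # x`. -/
noncomputable def e (g x : G) : TwistedDouble ω := basis ω (g, x)

/-- The unit `∑_g e_g # 1`. -/
noncomputable instance : One (TwistedDouble ω) := ⟨∑ g, e ω g 1⟩

theorem one_def : (1 : TwistedDouble ω) = ∑ g, e ω g 1 := rfl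

/-- To prove a statement closed under linear combinations it suffices to treat the basis. -/
theorem induct {p : TwistedDouble ω → Prop} (h0 : p 0) (hadd : ∀ a b, p a → p b → p (a + b))
    (hsmul : ∀ (c : k) a, p a → p (c • a)) (he : ∀ g x, p (e ω g x)) (a : TwistedDouble ω) :
    p a := by
  have ha := (basis ω).mem_span a
  induction ha using Submodule.span_induction with
  | mem x hx => obtain ⟨⟨g, y⟩, rfl⟩ := hx; exact he g y
  | zero => exact h0
  | add x y _ _ hx hy => exact hadd x y hx hy
  | smul c x _ hx => exact hsmul c x hx

variable [DecidableEq G]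

/-- The product, determined by `(e_g # x) (e_h # y) = δ_{g, x h x⁻¹} θ_g(x, y) e_g # xy`. -/
noncomputable def mulₗ : TwistedDouble ω →ₗ[k] TwistedDouble ω →ₗ[k] TwistedDouble ω :=
  (basis ω).constr k fun p => (basis ω).constr k fun q =>
    if p.1 = p.2 * q.1 * p.2⁻¹ then (ω.θ p.1 p.2 q.2 : k) • e ω p.1 (p.2 * q.2) else 0

noncomputable instance : Mul (TwistedDouble ω) := ⟨fun a b => mulₗ ω a b⟩

theorem mul_def (a b : TwistedDouble ω) : a * b = mulₗ ω a b := rfl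

theorem e_mul_e (g x h y : G) : e ω g x * e ω h y =
    if g = x * h * x⁻¹ then (ω.θ g x y : k) • e ω g (x * y) else 0 := by
  rw [mul_def, mulₗ, e, Module.Basis.constr_basis, e, Module.Basis.constr_basis]

theorem one_mulₗ : mulₗ ω 1 = LinearMap.id := by
  refine (basis ω).ext fun ⟨h, y⟩ => ?_
  change mulₗ ω 1 (e ω h y) = e ω h y
  rw [one_def, map_sum, LinearMap.sum_apply]
  simp only [← mul_def, e_mul_e]
  simp [ω.θ_one_left]

theorem mulₗ_one : (mulₗ ω).flip 1 = LinearMap.id := by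
  refine (basis ω).ext fun ⟨h, y⟩ => ?_
  change mulₗ ω (e ω h y) 1 = e ω h y
  rw [one_def, map_sum]
  simp only [← mul_def, e_mul_e]
  rw [Finset.sum_eq_single (y⁻¹ * h * y)]
  · simp [ω.θ_one_right, mul_assoc]
  · intro b _ hb
    rw [if_neg]
    rintro rfl
    exact hb (by group)
  · simp

theorem mulₗ_assoc (a b c : TwistedDouble ω) :
    mulₗ ω (mulₗ ω a b) c = mulₗ ω a (mulₗ ω b c) := by
  induction a using induct with
  | h0 => simp
  | hadd a a' h h' => simp [h, h']
  | hsmul r a h => simp [h]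
  | he g x =>
    induction b using induct with
    | h0 => simp
    | hadd a a' h h' => simp [h, h']
    | hsmul r a h => simp [h]
    | he h y =>
      induction c using induct with
      | h0 => simp
      | hadd a a' h h' => simp [h, h']
      | hsmul r a h => simp [h]
      | he l z =>
        simp only [← mul_def, e_mul_e]
        by_cases h1 : g = x * h * x⁻¹
        · by_cases h2 : h = y * l * y⁻¹
          · have h3 : g = x * y * l * (x * y)⁻¹ := by rw [h1, h2]; group
            rw [if_pos h1, if_pos h2]
            simp only [mul_def, map_smul, LinearMap.smul_apply]
            simp only [← mul_def, e_mul_e]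
            rw [if_pos h1, if_pos h3, smul_smul, smul_smul, mul_assoc]
            congr 1
            have h4 : x⁻¹ * g * x = h := by rw [h1]; group
            have := ω.θ_cocycle g x y z
            rw [h4] at this
            rw [← Units.val_mul, ← Units.val_mul, this, mul_comm]
          · have h3 : ¬ g = x * y * l * (x * y)⁻¹ := by
              intro h3
              apply h2
              rw [h1] at h3
              have := congrArg (fun t => x⁻¹ * t * x) h3
              simpa [mul_assoc] using this
            rw [if_pos h1, if_neg h2]
            simp only [mul_def, map_smul, LinearMap.smul_apply, map_zero]
            simp only [← mul_def, e_mul_e]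
            rw [if_neg h3, smul_zero]
        · rw [if_neg h1]
          split_ifs with h2
          · simp only [mul_def, map_smul, map_zero, LinearMap.zero_apply]
            simp only [← mul_def, e_mul_e]
            rw [if_neg h1, smul_zero]
          · simp [mul_def]

noncomputable instance : Ring (TwistedDouble ω) :=
  { (inferInstance : AddCommGroup (TwistedDouble ω)),
    (inferInstance : Mul (TwistedDouble ω)), (inferInstance : One (TwistedDouble ω)) with
    zero_mul := fun a => by simp [mul_def]
    mul_zero := fun a => by simp [mul_def]
    left_distrib := fun a b c => by simp [mul_def]
    right_distrib := fun a b c => by simp [mul_def]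
    mul_assoc := mulₗ_assoc ω
    one_mul := fun a => LinearMap.congr_fun (one_mulₗ ω) a
    mul_one := fun a => LinearMap.congr_fun (mulₗ_one ω) a }

noncomputable instance : Algebra k (TwistedDouble ω) :=
  Algebra.ofModule (fun r a b => by simp [mul_def]) (fun r a b => by simp [mul_def])

end Structure

variable [Fintype G] [DecidableEq G]

/-- The comultiplication, `Δ(e_g # x) = ∑_{st = g} γ_x(s, t) (e_s # x) ⊗ (e_t # x)`. -/
noncomputable def comulₗ : TwistedDouble ω →ₗ[k] TwistedDouble ω ⊗[k] TwistedDouble ω :=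
  (basis ω).constr k fun p =>
    ∑ s, (ω.γ p.2 s (s⁻¹ * p.1) : k) • (e ω s p.2 ⊗ₜ[k] e ω (s⁻¹ * p.1) p.2)

theorem comulₗ_e (g x : G) : comulₗ ω (e ω g x) =
    ∑ s, (ω.γ x s (s⁻¹ * g) : k) • (e ω s x ⊗ₜ[k] e ω (s⁻¹ * g) x) := by
  rw [comulₗ, e, Module.Basis.constr_basis]

/-- The counit, `ε(e_g # x) = δ_{g, 1}`. -/
noncomputable def counitₗ : TwistedDouble ω →ₗ[k] k :=
  (basis ω).constr k fun p => if p.1 = 1 then 1 else 0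

theorem counitₗ_e (g x : G) : counitₗ ω (e ω g x) = if g = 1 then 1 else 0 := by
  rw [counitₗ, e, Module.Basis.constr_basis]

theorem comulₗ_e_one (g : G) : comulₗ ω (e ω g 1) = ∑ s, e ω s 1 ⊗ₜ[k] e ω (s⁻¹ * g) 1 := by
  simp [comulₗ_e, ω.γ_one]

theorem comulₗ_one : comulₗ ω 1 = 1 := by
  rw [one_def, map_sum, Algebra.TensorProduct.one_def, one_def, TensorProduct.sum_tmul]
  simp only [comulₗ_e_one, TensorProduct.tmul_sum]
  rw [Finset.sum_comm]
  refine Finset.sum_congr rfl fun s _ => ?_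
  exact Fintype.sum_equiv (Equiv.mulLeft s⁻¹) _ _ fun _ => rfl

theorem comulₗ_mul (a b : TwistedDouble ω) : comulₗ ω (a * b) = comulₗ ω a * comulₗ ω b := by
  induction a using induct with
  | h0 => simp
  | hadd a a' h h' => simp [h, h', add_mul]
  | hsmul r a h => rw [smul_mul_assoc, map_smul, map_smul, h, smul_mul_assoc]
  | he g x =>
    induction b using induct with
    | h0 => simp
    | hadd a a' h h' => simp [h, h', mul_add]
    | hsmul r a h => rw [mul_smul_comm, map_smul, map_smul, h, mul_smul_comm]
    | he h y =>
      have step : ∀ s : G, (ω.γ x s (s⁻¹ * g) : k) • (e ω s x ⊗ₜ[k] e ω (s⁻¹ * g) x) *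
          comulₗ ω (e ω h y) = if g = x * h * x⁻¹ then ((ω.θ g x y : k) * ω.γ (x * y) s (s⁻¹ * g)) •
            (e ω s (x * y) ⊗ₜ[k] e ω (s⁻¹ * g) (x * y)) else 0 := by
        intro s
        rw [comulₗ_e, Finset.mul_sum, Finset.sum_eq_single (x⁻¹ * s * x)]
        · rw [smul_mul_smul_comm, Algebra.TensorProduct.tmul_mul_tmul, e_mul_e, e_mul_e,
            if_pos (by group)]
          by_cases hg : g = x * h * x⁻¹
          · have hh : x⁻¹ * g * x = h := by rw [hg]; group
            have hh' : (x⁻¹ * s * x)⁻¹ * h = x⁻¹ * (s⁻¹ * g) * x := by rw [← hh]; group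
            rw [if_pos hg, if_pos (by rw [hh']; group), hh', TensorProduct.smul_tmul_smul,
              smul_smul]
            congr 1
            have := ω.γ_mul x y s (s⁻¹ * g)
            rw [mul_inv_cancel_left] at this
            rw [← Units.val_mul, ← Units.val_mul, ← Units.val_mul, ← Units.val_mul, ← this]
            simp only [mul_assoc]
          · rw [if_neg hg, if_neg, TensorProduct.tmul_zero, smul_zero]
            intro h'
            apply hg
            have := congrArg (fun t => s * t) h'
            simpa [mul_assoc] using this
        · intro s' _ hs'
          rw [smul_mul_smul_comm, Algebra.TensorProduct.tmul_mul_tmul, e_mul_e, if_neg,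
            TensorProduct.zero_tmul, smul_zero]
          rintro rfl
          exact hs' (by group)
        · simp
      rw [comulₗ_e ω g x, Finset.sum_mul, Finset.sum_congr rfl fun s _ => step s, e_mul_e]
      split_ifs with hg
      · rw [map_smul, comulₗ_e, Finset.smul_sum]
        exact Finset.sum_congr rfl fun s _ => smul_smul _ _ _
      · simp

theorem counitₗ_one : counitₗ ω 1 = 1 := by
  simp [one_def, counitₗ_e]

theorem counitₗ_mul (a b : TwistedDouble ω) : counitₗ ω (a * b) = counitₗ ω a * counitₗ ω b := by
  induction a using induct with
  | h0 => simp
  | hadd a a' h h' => simp [h, h', add_mul]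
  | hsmul r a h => rw [smul_mul_assoc, map_smul, map_smul, h, smul_mul_assoc]
  | he g x =>
    induction b using induct with
    | h0 => simp
    | hadd a a' h h' => simp [h, h', mul_add]
    | hsmul r a h => rw [mul_smul_comm, map_smul, map_smul, h, mul_smul_comm]
    | he h y =>
      rw [e_mul_e, counitₗ_e, counitₗ_e]
      by_cases hg : g = 1
      · subst hg
        by_cases hh : h = 1
        · subst hh
          simp [counitₗ_e, NormalizedThreeCocycle.θ, ω.map_one_left, ω.map_one_mid,
            ω.map_one_right]
        · rw [if_neg, if_neg hh]
          · simp
          · intro h1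
            apply hh
            have := congrArg (fun t => x⁻¹ * t * x) h1
            simpa [mul_assoc] using this.symm
      · split_ifs <;> simp [counitₗ_e, hg]

/-- The comultiplication as an algebra map. -/
noncomputable def comul : TwistedDouble ω →ₐ[k] TwistedDouble ω ⊗[k] TwistedDouble ω :=
  AlgHom.ofLinearMap (comulₗ ω) (comulₗ_one ω) (comulₗ_mul ω)

/-- The counit as an algebra map. -/
noncomputable def counit : TwistedDouble ω →ₐ[k] k :=
  AlgHom.ofLinearMap (counitₗ ω) (counitₗ_one ω) (counitₗ_mul ω)

theorem comul_e (g x : G) : comul ω (e ω g x) =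
    ∑ s, (ω.γ x s (s⁻¹ * g) : k) • (e ω s x ⊗ₜ[k] e ω (s⁻¹ * g) x) := comulₗ_e ω g x

theorem comul_e_one (g : G) : comul ω (e ω g 1) = ∑ s, e ω s 1 ⊗ₜ[k] e ω (s⁻¹ * g) 1 :=
  comulₗ_e_one ω g

theorem counit_e (g x : G) : counit ω (e ω g x) = if g = 1 then 1 else 0 := counitₗ_e ω g x

theorem e_mul_e_one (s x a : G) : e ω s x * e ω a 1 = if a = x⁻¹ * s * x then e ω s x else 0 := by
  rw [e_mul_e, ω.θ_one_right, mul_one, Units.val_one, one_smul]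
  congr 1
  apply propext
  constructor
  · rintro rfl; group
  · rintro rfl; group

theorem e_one_mul_e (a s x : G) : e ω a 1 * e ω s x = if a = s then e ω s x else 0 := by
  rw [e_mul_e, ω.θ_one_left, one_mul, Units.val_one, one_smul, one_mul, inv_one, mul_one]
  split_ifs with h
  · rw [h]
  · rfl

/-- The element `∑ f(a, b, c) e_a ⊗ e_b ⊗ e_c` attached to a function `f` on `G³`. -/
noncomputable def diag (f : G → G → G → k) :
    TwistedDouble ω ⊗[k] (TwistedDouble ω ⊗[k] TwistedDouble ω) :=
  ∑ a, ∑ b, ∑ c, f a b c • (e ω a 1 ⊗ₜ[k] (e ω b 1 ⊗ₜ[k] e ω c 1))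

theorem tmul_mul_diag (f : G → G → G → k) (s t r x : G) :
    (e ω s x ⊗ₜ[k] (e ω t x ⊗ₜ[k] e ω r x)) * diag ω f =
      f (x⁻¹ * s * x) (x⁻¹ * t * x) (x⁻¹ * r * x) •
        (e ω s x ⊗ₜ[k] (e ω t x ⊗ₜ[k] e ω r x)) := by
  simp only [diag, Finset.mul_sum, mul_smul_comm, Algebra.TensorProduct.tmul_mul_tmul,
    e_mul_e_one]
  rw [Finset.sum_eq_single (x⁻¹ * s * x), Finset.sum_eq_single (x⁻¹ * t * x),
    Finset.sum_eq_single (x⁻¹ * r * x)]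
  · simp
  all_goals simp +contextual

theorem diag_mul_tmul (f : G → G → G → k) (s t r x : G) :
    diag ω f * (e ω s x ⊗ₜ[k] (e ω t x ⊗ₜ[k] e ω r x)) =
      f s t r • (e ω s x ⊗ₜ[k] (e ω t x ⊗ₜ[k] e ω r x)) := by
  simp only [diag, Finset.sum_mul, smul_mul_assoc, Algebra.TensorProduct.tmul_mul_tmul,
    e_one_mul_e]
  rw [Finset.sum_eq_single s, Finset.sum_eq_single t, Finset.sum_eq_single r]
  · simp
  all_goals simp +contextual

theorem diag_mul (f f' : G → G → G → k) :
    diag ω f * diag ω f' = diag ω fun a b c => f a b c * f' a b c := by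
  conv_lhs => rw [diag]
  simp only [Finset.sum_mul, smul_mul_assoc, tmul_mul_diag, smul_smul]
  simp [diag]

theorem diag_one : diag ω (fun _ _ _ => 1) = 1 := by
  simp only [diag, one_smul, Algebra.TensorProduct.one_def, one_def, ← TensorProduct.tmul_sum,
    ← TensorProduct.sum_tmul]

/-- The associator `φ = ∑ ω(a, b, c)⁻¹ e_a ⊗ e_b ⊗ e_c`. -/
noncomputable def associator :
    (TwistedDouble ω ⊗[k] (TwistedDouble ω ⊗[k] TwistedDouble ω))ˣ where
  val := diag ω fun a b c => (((ω a b c)⁻¹ : kˣ) : k)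
  inv := diag ω fun a b c => (ω a b c : k)
  val_inv := by simp [diag_mul, diag_one]
  inv_val := by simp [diag_mul, diag_one]

theorem quasi_coassoc (h : TwistedDouble ω) :
    Algebra.TensorProduct.map (AlgHom.id k (TwistedDouble ω)) (comul ω) (comul ω h) *
        (associator ω).val =
      (associator ω).val * Algebra.TensorProduct.assoc k k k (TwistedDouble ω) (TwistedDouble ω)
        (TwistedDouble ω) (Algebra.TensorProduct.map (comul ω)
          (AlgHom.id k (TwistedDouble ω)) (comul ω h)) := by
  induction h using induct with
  | h0 => simp
  | hadd a a' h h' => simp only [map_add, add_mul, mul_add, h, h']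
  | hsmul r a h => simp only [map_smul, smul_mul_assoc, mul_smul_comm, h]
  | he g x =>
    have e1 : Algebra.TensorProduct.map (AlgHom.id k (TwistedDouble ω)) (comul ω)
        (comul ω (e ω g x)) = ∑ s, ∑ t, ((ω.γ x s (s⁻¹ * g) * ω.γ x t (t⁻¹ * (s⁻¹ * g)) : kˣ) : k) •
          (e ω s x ⊗ₜ[k] (e ω t x ⊗ₜ[k] e ω (t⁻¹ * (s⁻¹ * g)) x)) := by
      simp only [comul_e, map_sum, map_smul, Algebra.TensorProduct.map_tmul, AlgHom.coe_id, id_eq,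
        TensorProduct.tmul_sum, TensorProduct.tmul_smul, Finset.smul_sum, smul_smul, Units.val_mul]
    have e2 : Algebra.TensorProduct.assoc k k k (TwistedDouble ω) (TwistedDouble ω)
        (TwistedDouble ω) (Algebra.TensorProduct.map (comul ω)
          (AlgHom.id k (TwistedDouble ω)) (comul ω (e ω g x))) =
        ∑ s, ∑ t, ((ω.γ x (s * t) (t⁻¹ * (s⁻¹ * g)) * ω.γ x s t : kˣ) : k) •
          (e ω s x ⊗ₜ[k] (e ω t x ⊗ₜ[k] e ω (t⁻¹ * (s⁻¹ * g)) x)) := by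
      simp only [comul_e, map_sum, map_smul, Algebra.TensorProduct.map_tmul, AlgHom.coe_id, id_eq,
        TensorProduct.sum_tmul, TensorProduct.smul_tmul', Finset.smul_sum, smul_smul,
        Algebra.TensorProduct.assoc_tmul, ← Units.val_mul]
      rw [Finset.sum_comm]
      refine Finset.sum_congr rfl fun s _ => ?_
      refine Fintype.sum_equiv (Equiv.mulLeft s⁻¹) _ _ fun u => ?_
      simp [mul_assoc]
    rw [e1, e2, Finset.sum_mul, Finset.mul_sum]
    refine Finset.sum_congr rfl fun s _ => ?_
    rw [Finset.sum_mul, Finset.mul_sum]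
    refine Finset.sum_congr rfl fun t _ => ?_
    rw [smul_mul_assoc, mul_smul_comm, associator, tmul_mul_diag, diag_mul_tmul, smul_smul,
      smul_smul, ← Units.val_mul, ← Units.val_mul]
    congr 2
    have := ω.γ_coassoc x s t (t⁻¹ * (s⁻¹ * g))
    rw [mul_inv_cancel_left] at this
    rw [this, mul_comm]

theorem orth_mul {ι A : Type*} [Fintype ι] [DecidableEq ι] [Ring A] [Algebra k A] {w : ι → A}
    (hw : ∀ i j, w i * w j = if i = j then w i else 0) (f f' : ι → k) :
    (∑ i, f i • w i) * (∑ i, f' i • w i) = ∑ i, (f i * f' i) • w i := by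
  simp only [Finset.sum_mul, Finset.mul_sum, smul_mul_smul_comm, hw, smul_ite, smul_zero,
    Finset.sum_ite_eq', Finset.mem_univ, if_true]

theorem orth_tmul {ι κ A B : Type*} [DecidableEq ι] [DecidableEq κ] [Ring A] [Algebra k A]
    [Ring B] [Algebra k B] {u : ι → A} {v : κ → B}
    (hu : ∀ i j, u i * u j = if i = j then u i else 0)
    (hv : ∀ i j, v i * v j = if i = j then v i else 0) (p q : ι × κ) :
    (u p.1 ⊗ₜ[k] v p.2) * (u q.1 ⊗ₜ[k] v q.2) = if p = q then u p.1 ⊗ₜ[k] v p.2 else 0 := by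
  rw [Algebra.TensorProduct.tmul_mul_tmul, hu, hv]
  by_cases h1 : p.1 = q.1 <;> by_cases h2 : p.2 = q.2 <;> simp [h1, h2, Prod.ext_iff]

/-- The element `∑ f(a, b, c, d) e_a ⊗ e_b ⊗ e_c ⊗ e_d` attached to a function `f` on `G⁴`. -/
noncomputable def diag₄ (f : G → G → G → G → k) :
    TwistedDouble ω ⊗[k] (TwistedDouble ω ⊗[k] (TwistedDouble ω ⊗[k] TwistedDouble ω)) :=
  ∑ a, ∑ b, ∑ c, ∑ d, f a b c d •
    (e ω a 1 ⊗ₜ[k] (e ω b 1 ⊗ₜ[k] (e ω c 1 ⊗ₜ[k] e ω d 1)))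

theorem e_orth (i j : G) : e ω i 1 * e ω j 1 = if i = j then e ω i 1 else 0 := by
  rw [e_one_mul_e]
  split_ifs with h
  · rw [h]
  · rfl

theorem diag₄_mul (f f' : G → G → G → G → k) :
    diag₄ ω f * diag₄ ω f' = diag₄ ω fun a b c d => f a b c d * f' a b c d := by
  have key : ∀ f : G → G → G → G → k, diag₄ ω f = ∑ p : G × G × G × G,
      f p.1 p.2.1 p.2.2.1 p.2.2.2 •
        (e ω p.1 1 ⊗ₜ[k] (e ω p.2.1 1 ⊗ₜ[k] (e ω p.2.2.1 1 ⊗ₜ[k] e ω p.2.2.2 1))) := by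
    intro f
    simp only [diag₄, Fintype.sum_prod_type]
  rw [key, key, key]
  exact orth_mul (orth_tmul (e_orth ω) (orth_tmul (e_orth ω) (orth_tmul (e_orth ω) (e_orth ω))))
    _ _

theorem map_id_id_comul (f : G → G → G → k) :
    Algebra.TensorProduct.map (AlgHom.id k (TwistedDouble ω))
      (Algebra.TensorProduct.map (AlgHom.id k (TwistedDouble ω)) (comul ω)) (diag ω f) =
      diag₄ ω fun a b c d => f a b (c * d) := by
  simp only [diag, diag₄, map_sum, map_smul, Algebra.TensorProduct.map_tmul, AlgHom.coe_id, id_eq,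
    comul_e_one, TensorProduct.tmul_sum, Finset.smul_sum]
  refine Finset.sum_congr rfl fun a _ => Finset.sum_congr rfl fun b _ => ?_
  rw [Finset.sum_comm]
  refine Finset.sum_congr rfl fun s _ => ?_
  exact Fintype.sum_equiv (Equiv.mulLeft s⁻¹) _ _ fun u => by simp

theorem map_comul_id_id (f : G → G → G → k) :
    Algebra.TensorProduct.assoc k k k (TwistedDouble ω) (TwistedDouble ω)
      (TwistedDouble ω ⊗[k] TwistedDouble ω) (Algebra.TensorProduct.map (comul ω)
        (AlgHom.id k (TwistedDouble ω ⊗[k] TwistedDouble ω)) (diag ω f)) =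
      diag₄ ω fun a b c d => f (a * b) c d := by
  simp only [diag, diag₄, map_sum, map_smul, Algebra.TensorProduct.map_tmul, AlgHom.coe_id, id_eq,
    comul_e_one, TensorProduct.sum_tmul, Finset.smul_sum, Algebra.TensorProduct.assoc_tmul]
  trans ∑ u, ∑ s, ∑ c, ∑ d, f u c d • (e ω s 1 ⊗ₜ[k] (e ω (s⁻¹ * u) 1 ⊗ₜ[k]
    (e ω c 1 ⊗ₜ[k] e ω d 1)))
  · refine Finset.sum_congr rfl fun u _ => ?_
    exact (Finset.sum_congr rfl fun c _ => Finset.sum_comm).trans Finset.sum_comm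
  rw [Finset.sum_comm]
  refine Finset.sum_congr rfl fun s _ => ?_
  exact Fintype.sum_equiv (Equiv.mulLeft s⁻¹) _ _ fun u => by simp

theorem map_id_comul_id (f : G → G → G → k) :
    Algebra.TensorProduct.map (AlgHom.id k (TwistedDouble ω))
      ((Algebra.TensorProduct.assoc k k k (TwistedDouble ω) (TwistedDouble ω)
        (TwistedDouble ω)).toAlgHom.comp (Algebra.TensorProduct.map (comul ω)
          (AlgHom.id k (TwistedDouble ω)))) (diag ω f) =
      diag₄ ω fun a b c d => f a (b * c) d := by
  simp only [diag, diag₄, map_sum, map_smul, Algebra.TensorProduct.map_tmul, AlgHom.coe_id, id_eq,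
    comul_e_one, TensorProduct.sum_tmul, TensorProduct.tmul_sum, Finset.smul_sum,
    Algebra.TensorProduct.assoc_tmul, AlgHom.comp_apply, AlgEquiv.toAlgHom_apply]
  refine Finset.sum_congr rfl fun a _ => ?_
  trans ∑ u, ∑ s, ∑ d, f a u d • (e ω a 1 ⊗ₜ[k] (e ω s 1 ⊗ₜ[k]
    (e ω (s⁻¹ * u) 1 ⊗ₜ[k] e ω d 1)))
  · exact Finset.sum_congr rfl fun u _ => Finset.sum_comm
  rw [Finset.sum_comm]
  refine Finset.sum_congr rfl fun s _ => ?_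
  exact Fintype.sum_equiv (Equiv.mulLeft s⁻¹) _ _ fun u => by simp

theorem one_tmul_diag (f : G → G → G → k) :
    (1 : TwistedDouble ω) ⊗ₜ[k] diag ω f = diag₄ ω fun _ b c d => f b c d := by
  rw [one_def, TensorProduct.sum_tmul]
  simp only [diag, diag₄, TensorProduct.tmul_sum, TensorProduct.tmul_smul]

theorem diag_tmul_one (f : G → G → G → k) :
    Algebra.TensorProduct.map (AlgHom.id k (TwistedDouble ω))
      (Algebra.TensorProduct.assoc k k k (TwistedDouble ω) (TwistedDouble ω)
        (TwistedDouble ω)).toAlgHom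
      (Algebra.TensorProduct.assoc k k k (TwistedDouble ω) (TwistedDouble ω ⊗[k] TwistedDouble ω)
        (TwistedDouble ω) (diag ω f ⊗ₜ[k] (1 : TwistedDouble ω))) =
      diag₄ ω fun a b c _ => f a b c := by
  simp only [diag, diag₄, TensorProduct.sum_tmul, ← TensorProduct.smul_tmul', map_sum, map_smul,
    Algebra.TensorProduct.assoc_tmul, Algebra.TensorProduct.map_tmul, AlgHom.coe_id, id_eq,
    AlgEquiv.toAlgHom_apply]
  simp only [one_def, TensorProduct.tmul_sum, Finset.smul_sum]

/-- The quasi-bialgebra structure of the twisted quantum double `D^ω G`. -/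
noncomputable instance : QuasiBialgebra k (TwistedDouble ω) where
  Δ := comul ω
  ε := counit ω
  φ := associator ω
  counit_left h := by
    induction h using induct with
    | h0 => simp
    | hadd a a' h h' => simp only [map_add, h, h']
    | hsmul r a h => simp only [map_smul, h]
    | he g x =>
      simp only [comul_e, map_sum, map_smul, Algebra.TensorProduct.map_tmul, AlgHom.coe_id, id_eq,
        counit_e, Algebra.TensorProduct.lid_tmul]
      rw [Finset.sum_eq_single 1]
      · simp [ω.γ_one_left]
      · intro s _ hs
        simp [hs]
      · simp
  counit_right h := by
    induction h using induct with
    | h0 => simp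
    | hadd a a' h h' => simp only [map_add, h, h']
    | hsmul r a h => simp only [map_smul, h]
    | he g x =>
      simp only [comul_e, map_sum, map_smul, Algebra.TensorProduct.map_tmul, AlgHom.coe_id, id_eq,
        counit_e, Algebra.TensorProduct.rid_tmul]
      rw [Finset.sum_eq_single g]
      · simp [ω.γ_one_right]
      · intro s _ hs
        have : ¬ s⁻¹ * g = 1 := fun h => hs (inv_mul_eq_one.mp h)
        simp [this]
      · simp
  quasi_coassoc := quasi_coassoc ω
  pentagon := by
    simp only [associator]
    rw [map_id_id_comul, map_comul_id_id, map_id_comul_id, one_tmul_diag, diag_tmul_one,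
      diag₄_mul, diag₄_mul, diag₄_mul]
    congr 1
    funext a b c d
    simp only [← Units.val_mul]
    congr 1
    have := ω.cocycle a b c d
    rw [← mul_inv, ← mul_inv, ← mul_inv, this, mul_comm]
  counit_assoc := by
    simp only [associator, diag, map_sum, map_smul, Algebra.TensorProduct.map_tmul, AlgHom.coe_id,
      id_eq, counit_e, AlgHom.comp_apply, AlgEquiv.toAlgHom_apply, Algebra.TensorProduct.lid_tmul]
    trans ∑ a, ∑ c, e ω a 1 ⊗ₜ[k] e ω c 1
    · refine Finset.sum_congr rfl fun a _ => ?_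
      rw [Finset.sum_eq_single 1]
      · simp [ω.map_one_mid]
      · intro b _ hb
        simp [hb]
      · simp
    · simp only [Algebra.TensorProduct.one_def, one_def, ← TensorProduct.tmul_sum,
        ← TensorProduct.sum_tmul]

end TwistedDouble

/-! The theorem reduces to computing powers of the double braiding as scalars on explicit vectors.
By naturality, a half-braiding is determined by its value on the regular representation, so it has
the form `x ⊗ y ↦ ∑ (e_h # a) y ⊗ T_{h,a} x`. Linearity over the double says how the group action
conjugates the `T_{h,a}` (`coef_act`). The hexagon says that `T_{l,b} T_{h,a}` vanishes for `b ≠ a`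
and is a scalar times `T_{hl,a}` for `b = a` (`coef_coef`). Hence the `T_{1,a}` are orthogonal
idempotents with sum `1`, and every object of the center is spanned by vectors with a degree `s` and
a label `a` (`IsHomog`).

The operator `θ_X = ∑ (e_h # a) T_{h,a}` is natural and balances the braiding: `θ_{X ⊗ Y} = β² (θ_X
⊗ θ_Y)` (`twist₂_eq`). Naturality makes the factors commute, so powers of `β²` are governed by
powers of twists. On a vector of degree `s = pa` and label `a`, the twist is a product of two
commuting operators. Their `n`-th powers contribute `π_n(a)` and `π_n(p)⁻¹`, so when `g^n = 1` for
all `g` the power `θ_X^n` is the scalar `π_n(a) / π_n(sa⁻¹)` (`twist_pow_of_pow_eq_one`). If `π_n`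
is a character, these scalars are multiplicative in both degree and label, and `β^{2n} = 1`.

For the converse, the braiding `v ⊗ w ↦ s w ⊗ v` (with `v` of degree `s`) places every
representation in the center, with label equal to degree. On the regular representation, `β^{2n} =
1` forces `g^n = 1`. The surviving scalar `π_n(gh) / (π_n(g) π_n(h))` must then be `1`.

Unipotence is no weaker than triviality here. The cocycle `ω^{|G|}` is a coboundary, so `π_m = 1`
for `m = |G|²`, and `β²` has finite order. In characteristic zero a unipotent operator of finite
order is the identity. -/

/-! ### Scalar identities from the 3-cocycle condition -/

namespace NormalizedThreeCocycle

variable {G : Type v} {k : Type u} [Group G] [Field k] (ω : NormalizedThreeCocycle G k)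

/-- The scalar by which the action of `w` commutes past a coefficient `T_{h,a}` of a half-braiding
on vectors of degree `s`. -/
def linScalar (w s h a : G) : kˣ :=
  ω.γ w (w * h * w⁻¹) (w * (h⁻¹ * s * (a⁻¹ * h * a)) * w⁻¹) * ω.θ (w * h * w⁻¹) w a /
    (ω.γ w (w * s * w⁻¹) (w * (a⁻¹ * h * a) * w⁻¹) * ω.θ (w * h * w⁻¹) (w * a * w⁻¹) w)

/-- The scalar relating `T_{l,a} T_{h,a}` to `T_{hl,a}` on vectors of degree `s`. -/
def hexScalar (h l s a : G) : kˣ :=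
  ω.γ a h l * ω h (h⁻¹ * s * (a⁻¹ * h * a)) (a⁻¹ * l * a) /
    (ω s (a⁻¹ * h * a) (a⁻¹ * l * a) *
      ω h l (l⁻¹ * (h⁻¹ * s * (a⁻¹ * h * a)) * (a⁻¹ * l * a)))

/-- The scalar relating the coefficient `T_{h,ab}` on a tensor product to `T_{h,a} ⊗ T_{a⁻¹ha,b}`
on vectors of degrees `s` and `t`. -/
def tensorScalar (s t h a b : G) : kˣ :=
  ω s (a⁻¹ * h * a) ((a⁻¹ * h * a)⁻¹ * t * (b⁻¹ * (a⁻¹ * h * a) * b)) * ω.θ h a b /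
    (ω s t (b⁻¹ * (a⁻¹ * h * a) * b) *
      ω h (h⁻¹ * s * (a⁻¹ * h * a)) ((a⁻¹ * h * a)⁻¹ * t * (b⁻¹ * (a⁻¹ * h * a) * b)))

/-- This is the scalar content of the balancing identity on `x ⊗ y`, with labels `a`, `b` and with
`y` of degree `t`. The degree of `x` is parametrized as `a t r a⁻¹ t⁻¹` so that the arguments on
both sides reduce to short words. In additive notation the claim is an integral combination of
eleven instances of the cocycle condition. -/
theorem balancing_aux (a b t r : G) :
    ω.tensorScalar (a * t * r * a⁻¹ * t⁻¹) t (a * t * r * a⁻¹) a b *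
        ω.γ (a * b) (a * b * r * (a * b)⁻¹)
          (a * b * (r⁻¹ * b⁻¹ * t * r * b) * (a * b)⁻¹) =
      ω.linScalar a (t * r * a⁻¹ * t⁻¹ * a) t a *
        ω.hexScalar (a * t * r * a⁻¹ * t⁻¹) t (a * t * r * a⁻¹ * t⁻¹) a *
        ω.θ (a * b * r * (a * b)⁻¹) (a * b * a⁻¹) a *
      (ω.θ (a * t * a⁻¹) a b * ω.linScalar (a * b) (b⁻¹ * t * b) r b *
        ω.hexScalar t r t b) := by
  have h1 := ω.cocycle_add (a * t * r * a⁻¹ * t⁻¹) t r (r⁻¹ * b⁻¹ * t * r * b)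
  have h2 := ω.cocycle_add (a * t * a⁻¹) a r b
  have h3 := ω.cocycle_add (a * t * a⁻¹) (a * r * a⁻¹) a b
  have h4 := ω.cocycle_add (a * b * a⁻¹) (a * r * a⁻¹) a b
  have h5 := ω.cocycle_add (a * b * a⁻¹) a r b
  have h6 := ω.cocycle_add (a * b * a⁻¹) a b (b⁻¹ * r * b)
  have h7 := ω.cocycle_add (a * b * r * b⁻¹ * a⁻¹) (a * b * a⁻¹) a b
  have h8 := ω.cocycle_add a t r b
  have h9 := ω.cocycle_add (a * t * a⁻¹) a b (b⁻¹ * r * b)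
  have h10 := ω.cocycle_add a t b (b⁻¹ * r * b)
  have h11 := ω.cocycle_add a b (b⁻¹ * t * b) (b⁻¹ * r * b)
  apply Additive.ofMul.injective
  simp only [tensorScalar, linScalar, hexScalar, θ, γ, ofMul_mul, ofMul_div]
  simp only [mul_assoc, mul_inv_rev, mul_inv_cancel_left, inv_mul_cancel_left, inv_inv,
    inv_mul_cancel, mul_inv_cancel, mul_one, one_mul] at h1 h2 h3 h4 h5 h6 h7 h8 h9 h10 h11 ⊢
  grind

/-- When degree and label agree the factors cancel in pairs, without the cocycle condition. This
makes the braiding of representations linear over the double. -/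
theorem linScalar_of_diag (w h a : G) : ω.linScalar w a h a = 1 := by
  apply Additive.ofMul.injective
  simp only [linScalar, θ, γ, ofMul_mul, ofMul_div, ofMul_one]
  simp only [mul_assoc, mul_inv_rev, mul_inv_cancel_left, inv_mul_cancel_left, inv_inv,
    inv_mul_cancel, mul_inv_cancel, mul_one, one_mul]
  abel

/-- Responsible for the commutation of `leftTwist` and `rightTwist` on vectors of degree `pa` and
label `a`. -/
theorem hexScalar_comm (p a : G) : ω.hexScalar p a (p * a) a =
    ω.linScalar a (a⁻¹ * (p * a) * a) (a⁻¹ * p * a) a * ω.hexScalar a (a⁻¹ * p * a) (p * a) a := by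
  apply Additive.ofMul.injective
  simp only [hexScalar, linScalar, θ, γ, ofMul_mul, ofMul_div]
  simp only [mul_assoc, mul_inv_rev, mul_inv_cancel_left, inv_mul_cancel_left, inv_inv,
    inv_mul_cancel, mul_inv_cancel, mul_one, one_mul]
  abel

/-- With `h = a^n`, this collects everything produced by one further application of `leftTwist` into
a single `θ`. -/
theorem linScalar_mul_hexScalar (s a h : G) (hc : a * h = h * a) :
    ω.linScalar h (h⁻¹ * s * h) a a * ω.hexScalar h a s a * ω.θ s a h = ω.θ a a h := by
  have e1 : a⁻¹ * h * a = h := by rw [mul_assoc, ← hc, inv_mul_cancel_left]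
  have e2 : h * a * h⁻¹ = a := by rw [← hc, mul_inv_cancel_right]
  have e3 : h⁻¹ * a * h = a := by rw [mul_assoc, hc, inv_mul_cancel_left]
  have e4 : a⁻¹ * (h * a) = h := by rw [← hc, inv_mul_cancel_left]
  have e5 : h * (a * h⁻¹) = a := by rw [← mul_assoc, e2]
  have e6 : a⁻¹ * (h⁻¹ * (a * (h * a))) = a := by
    rw [← mul_assoc a, hc, mul_assoc, inv_mul_cancel_left, inv_mul_cancel_left]
  have e8 : ∀ z, h⁻¹ * (a⁻¹ * z) = a⁻¹ * (h⁻¹ * z) := fun z => by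
    rw [← mul_assoc, ← mul_inv_rev, hc, mul_inv_rev, mul_assoc]
  have e7 : ∀ z, h * (a⁻¹ * (h⁻¹ * z)) = a⁻¹ * z := fun z => by
    rw [← mul_assoc a⁻¹, ← mul_inv_rev, ← hc, mul_inv_rev, mul_assoc, mul_inv_cancel_left]
  apply Additive.ofMul.injective
  simp only [hexScalar, linScalar, θ, γ, ofMul_mul, ofMul_div, e1, e2, e3, hc]
  simp only [mul_assoc, mul_inv_rev, mul_inv_cancel_left, inv_mul_cancel_left, inv_inv,
    inv_mul_cancel, mul_inv_cancel, mul_one, one_mul, e4, e5, e6, e7, e8, hc]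
  abel

/-- Explains the normalization of `rightTwist`: its factor cancels the scalar in `T_{a,a} T_{p,a}`.
-/
theorem hexScalar_twist (p a : G) :
    ω p a (a⁻¹ * p * a) * ω.hexScalar p a (p * a) a = 1 := by
  have h1 := ω.cocycle_add p a (a⁻¹ * p * a) a
  apply Additive.ofMul.injective
  simp only [hexScalar, γ, ofMul_mul, ofMul_div, ofMul_one]
  simp only [mul_assoc, mul_inv_rev, mul_inv_cancel_left, inv_mul_cancel_left, inv_inv,
    inv_mul_cancel, mul_inv_cancel, mul_one, one_mul] at h1 ⊢
  grind

/-- The scalar normalizing `T_{h,a}` for `h` a power of `p`. -/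
def powScalar (p a h : G) : kˣ := ω p a (a⁻¹ * h * a) * ω h p a / ω p h a

theorem powScalar_self (p a : G) : ω.powScalar p a p = ω p a (a⁻¹ * p * a) := by
  simp [powScalar]

theorem powScalar_one (p a : G) : ω.powScalar p a 1 = 1 := by
  simp [powScalar, map_one_left, map_one_mid, map_one_right]

/-- Up to the factor `ω(p, h, p)`, rescaling `T_{h,a}` by `powScalar` removes the hexagon scalar for
multiplication by `p`. That factor, taken at `h = p^n`, is what builds up `π_n(p)`. -/
theorem powScalar_mul (p a h : G) (hc : p * h = h * p) :
    ω.powScalar p a p * ω.powScalar p a h * ω.hexScalar h p (p * a) a * ω p h p =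
      ω.powScalar p a (h * p) := by
  have e1 : h⁻¹ * (p * (h * a)) = p * a := by
    rw [← mul_assoc p, hc, mul_assoc, inv_mul_cancel_left]
  have e2 : h * (p * a) = p * (h * a) := by rw [← mul_assoc, ← hc, mul_assoc]
  have h1 := ω.cocycle_add p h a (a⁻¹ * p * a)
  have h2 := ω.cocycle_add p a (a⁻¹ * h * a) (a⁻¹ * p * a)
  have h3 := ω.cocycle_add h p a (a⁻¹ * p * a)
  have h4 := ω.cocycle_add p h p a
  apply Additive.ofMul.injective
  simp only [powScalar, hexScalar, γ, ofMul_mul, ofMul_div, ← hc] at h4 ⊢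
  simp only [mul_assoc, mul_inv_rev, mul_inv_cancel_left, inv_mul_cancel_left, inv_inv,
    inv_mul_cancel, mul_inv_cancel, mul_one, one_mul, e1, e2, ← hc] at h1 h2 h3 h4 ⊢
  grind

/-! ### The functions `π_n` -/

theorem piMap_succ (n : ℕ) (g : G) : ω.piMap (n + 1) g = ω g (g ^ n) g * ω.piMap n g := by
  rcases n with _ | n
  -- The product defining `π` starts at `j = 1`; for `n = 0` the extra factor `ω(g, 1, g)` is `1` by
  -- normalization.
  · simp [piMap, map_one_mid]
  · rw [piMap, Finset.prod_Ico_succ_top (by omega), mul_comm]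
    rfl

theorem piMap_one_right (n : ℕ) : ω.piMap n 1 = 1 := by
  simp [piMap, map_one_left]

theorem piMap_add {n : ℕ} (m : ℕ) {g : G} (hg : g ^ n = 1) :
    ω.piMap (n + m) g = ω.piMap n g * ω.piMap m g := by
  induction m with
  | zero => simp [piMap]
  | succ m ih => rw [← add_assoc, piMap_succ, ih, piMap_succ, pow_add, hg, one_mul, mul_left_comm]

theorem piMap_mul {n : ℕ} (m : ℕ) {g : G} (hg : g ^ n = 1) :
    ω.piMap (n * m) g = ω.piMap n g ^ m := by
  induction m with
  | zero => simp [piMap]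
  | succ m ih => rw [mul_add_one, add_comm, piMap_add ω _ hg, ih, pow_succ']

/-- Multiplying the cocycle condition over its last variable shows that `ω^{|G|}` is the coboundary
of `f(x, y) = ∏_w ω(x, y, w)`. Along the powers of `g` the product telescopes to `f(g^n, g) / f(g,
g^n)`, which is `1` when `g^n = 1`. -/
theorem piMap_pow_card [Fintype G] {n : ℕ} {g : G} (hg : g ^ n = 1) :
    ω.piMap n g ^ Fintype.card G = 1 := by
  let f : G → G → kˣ := fun x y => ∏ w, ω x y w
  have hf : ∀ x y z, f y z * f x (y * z) * ω x y z ^ Fintype.card G = f (x * y) z * f x y := by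
    intro x y z
    have h := Finset.prod_congr rfl fun w (_ : w ∈ Finset.univ) => ω.cocycle x y z w
    simp only [Finset.prod_mul_distrib, Finset.prod_const, Finset.card_univ] at h
    -- The substitution `zw ↦ w` turns the product of `ω(x, y, zw)` into `f(x, y)`.
    rw [Fintype.prod_equiv (Equiv.mulLeft z) (fun w => ω x y (z * w)) (fun w => ω x y w)
      fun w => rfl] at h
    exact h
  have key : ∀ m : ℕ, f g (g ^ m) * ω.piMap m g ^ Fintype.card G = f (g ^ m) g := by
    intro m
    induction m with
    | zero => simp [f, piMap, map_one_left, map_one_mid]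
    | succ m ih =>
      have h := hf g (g ^ m) g
      rw [← pow_succ, ← pow_succ', ← ih] at h
      rw [piMap_succ, mul_pow]
      refine mul_left_cancel (a := f g (g ^ m)) ?_
      simpa only [mul_comm, mul_left_comm, mul_assoc] using h
  simpa [hg, f, map_one_left, map_one_mid] using key n

end NormalizedThreeCocycle

/-! ### Half-braidings over a finite-dimensional quasi-bialgebra -/

namespace FDModule

open QuasiBialgebra

variable {k : Type u} {H : Type v} [Field k] [Ring H] [Algebra k H]

/-- The action on a fixed vector, as a linear map. -/
def evalAt (Y : FDModule k H) (y : Y.V) : H →ₗ[k] Y.V :=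
  (LinearMap.applyₗ y) ∘ₗ Y.ρ.toLinearMap

@[simp]
theorem evalAt_apply (Y : FDModule k H) (y : Y.V) (h : H) : evalAt Y y h = Y.ρ h y := rfl

section Regular

variable (k H) [FiniteDimensional k H]

/-- The regular representation of a finite-dimensional algebra, transported to the coordinate space
of a basis. -/
noncomputable def regular : FDModule k H where
  -- Carriers of `FDModule` lie in the universe of `k`, while `H` may lie in another; coordinates
  -- bridge the two.
  V := Fin (Module.finrank k H) → k
  ρ := ((LinearEquiv.conjAlgEquiv k (Module.finBasis k H).equivFun).toAlgHom).comp
    (Algebra.lmul k H)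

/-- The underlying space of the regular representation. -/
noncomputable def regularEquiv : (regular k H).V ≃ₗ[k] H := (Module.finBasis k H).equivFun.symm

variable {k H}

theorem regularEquiv_ρ (h : H) (x : (regular k H).V) :
    regularEquiv k H ((regular k H).ρ h x) = h * regularEquiv k H x := by
  exact (Module.finBasis k H).equivFun.symm_apply_apply _

/-- The map from the regular representation sending `1` to a given vector. -/
noncomputable def orbitHom (Y : FDModule k H) (y : Y.V) : regular k H ⟶ Y where
  hom := evalAt Y y ∘ₗ (regularEquiv k H).toLinearMap
  comm h x := by simp [regularEquiv_ρ]

end Regular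

variable [QuasiBialgebra k H]

/-- The half-braiding of an object of the center, as a linear map. -/
noncomputable def halfBraid (X : Center (FDModule k H)) (Y : FDModule k H) :
    X.1.V ⊗[k] Y.V →ₗ[k] Y.V ⊗[k] X.1.V :=
  (X.2.β Y).hom.hom

theorem halfBraid_ρ (X : Center (FDModule k H)) (Y : FDModule k H) (h : H)
    (z : X.1.V ⊗[k] Y.V) :
    halfBraid X Y (tensorAct X.1.ρ Y.ρ (Δ h) z) = tensorAct Y.ρ X.1.ρ (Δ h) (halfBraid X Y z) :=
  (X.2.β Y).hom.comm h z

theorem halfBraid_naturality (X : Center (FDModule k H)) {Y Y' : FDModule k H} (f : Y ⟶ Y')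
    (z : X.1.V ⊗[k] Y.V) :
    halfBraid X Y' (TensorProduct.map LinearMap.id f.hom z) =
      TensorProduct.map f.hom LinearMap.id (halfBraid X Y z) :=
  LinearMap.congr_fun (congrArg Hom.hom (X.2.naturality f)) z

theorem halfBraid_hom {X X' : Center (FDModule k H)} (f : X ⟶ X') (Y : FDModule k H)
    (z : X.1.V ⊗[k] Y.V) :
    halfBraid X' Y (TensorProduct.map f.f.hom LinearMap.id z) =
      TensorProduct.map LinearMap.id f.f.hom (halfBraid X Y z) :=
  LinearMap.congr_fun (congrArg Hom.hom (f.comm Y)) z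

theorem halfBraid_injective (X : Center (FDModule k H)) (Y : FDModule k H) :
    Function.Injective (halfBraid X Y) := by
  refine Function.LeftInverse.injective (g := (X.2.β Y).inv.hom) fun z => ?_
  exact LinearMap.congr_fun (congrArg Hom.hom (X.2.β Y).hom_inv_id) z

/-- The first hexagon. -/
theorem halfBraid_tensor (X : Center (FDModule k H)) (Y Z : FDModule k H)
    (z : (X.1.V ⊗[k] Y.V) ⊗[k] Z.V) :
    associatorEquiv Y Z X.1 (halfBraid X (tensor Y Z) (associatorEquiv X.1 Y Z z)) =
      TensorProduct.map LinearMap.id (halfBraid X Z) (associatorEquiv Y X.1 Z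
        (TensorProduct.map (halfBraid X Y) LinearMap.id z)) := by
  have h : (α_ X.1 Y Z).hom ≫ (X.2.β (Y ⊗ Z)).hom ≫ (α_ Y Z X.1).hom =
      ((X.2.β Y).hom ▷ Z) ≫ (α_ Y X.1 Z).hom ≫ (Y ◁ (X.2.β Z).hom) := by
    rw [X.2.monoidal]
    simp
  exact LinearMap.congr_fun (congrArg Hom.hom h) z

/-- The half-braiding of a tensor product. -/
theorem halfBraid_tensorObj (X Y : Center (FDModule k H)) (U : FDModule k H)
    (z : (X.1.V ⊗[k] Y.1.V) ⊗[k] U.V) (w : (X.1.V ⊗[k] U.V) ⊗[k] Y.1.V)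
    (h : associatorEquiv X.1 U Y.1 w =
      TensorProduct.map LinearMap.id (halfBraid Y U) (associatorEquiv X.1 Y.1 U z)) :
    halfBraid (X ⊗ Y) U z =
      associatorEquiv U X.1 Y.1 (TensorProduct.map (halfBraid X U) LinearMap.id w) := by
  rw [← LinearEquiv.eq_symm_apply] at h
  rw [h]
  rfl

theorem doubleBraiding_apply (X Y : Center (FDModule k H)) (z : X.1.V ⊗[k] Y.1.V) :
    doubleBraiding X Y z = halfBraid Y X.1 (halfBraid X Y.1 z) := rfl

variable [FiniteDimensional k H]

/-- The element `∑ hᵢ ⊗ xᵢ` of `H ⊗ X` such that the half-braiding of `X` is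
`x ⊗ y ↦ ∑ hᵢ y ⊗ xᵢ`. -/
noncomputable def coact (X : Center (FDModule k H)) : X.1.V →ₗ[k] H ⊗[k] X.1.V :=
  TensorProduct.map (regularEquiv k H).toLinearMap LinearMap.id ∘ₗ
    halfBraid X (regular k H) ∘ₗ
      (TensorProduct.mk k X.1.V (regular k H).V).flip ((regularEquiv k H).symm 1)

/-- A Yoneda argument: naturality along the map `H → Y`, `1 ↦ y`, transports the value at `x ⊗ 1` to
the value at `x ⊗ y`. -/
theorem halfBraid_tmul (X : Center (FDModule k H)) (Y : FDModule k H) (x : X.1.V) (y : Y.V) :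
    halfBraid X Y (x ⊗ₜ y) = TensorProduct.map (evalAt Y y) LinearMap.id (coact X x) := by
  have h := halfBraid_naturality X (orbitHom Y y) (x ⊗ₜ[k] (regularEquiv k H).symm 1)
  have e : TensorProduct.map LinearMap.id (orbitHom Y y).hom
      (x ⊗ₜ[k] (regularEquiv k H).symm 1) = x ⊗ₜ[k] y := by
    simp [orbitHom]
  rw [e] at h
  rw [h]
  simp only [coact, LinearMap.comp_apply, LinearMap.flip_apply, TensorProduct.mk_apply]
  rw [← LinearMap.comp_apply (TensorProduct.map (evalAt Y y) LinearMap.id),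
    ← TensorProduct.map_comp, LinearMap.id_comp]
  rfl

end FDModule

/-! ### Homogeneous vectors in representations of the twisted double -/

namespace TwistedDouble

open FDModule

variable {G : Type v} {k : Type u} [Group G] [Field k] {ω : NormalizedThreeCocycle G k}
  [Fintype G] [DecidableEq G]

instance : FiniteDimensional k (TwistedDouble ω) := Module.Basis.finiteDimensional_of_finite (basis ω)

variable (ω) in
/-- The element `∑_g e_g # w`. -/
noncomputable def grp (w : G) : TwistedDouble ω := ∑ g, e ω g w

theorem grp_one : grp ω 1 = 1 := rfl

theorem grp_mul_e_one (w s : G) : grp ω w * e ω s 1 = e ω (w * s * w⁻¹) w := by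
  simp only [grp, Finset.sum_mul, e_mul_e_one]
  rw [Finset.sum_eq_single (w * s * w⁻¹)]
  · simp [mul_assoc]
  · intro g _ hg
    rw [if_neg]
    rintro rfl
    exact hg (by group)
  · simp

variable (V W Z : FDModule k (TwistedDouble ω))

/-- Vectors of degree `s` of a representation of `D^ω G`. -/
def IsDeg (s : G) (x : V.V) : Prop := V.ρ (e ω s 1) x = x

/-- The action of `∑_g e_g # w`. -/
noncomputable def act (w : G) : Module.End k V.V := V.ρ (grp ω w)

variable {V W Z}

theorem act_one (x : V.V) : act V 1 x = x := by
  simp [act, grp_one]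

theorem ρ_mul_apply (a b : TwistedDouble ω) (x : V.V) : V.ρ (a * b) x = V.ρ a (V.ρ b x) := by
  rw [map_mul]
  rfl

/-- The element `e_g # w` lands in degree `g`, while `w` conjugates degrees, so only `g = w s w⁻¹`
survives. -/
theorem IsDeg.ρ_e {s : G} {x : V.V} (hx : IsDeg V s x) (g w : G) :
    V.ρ (e ω g w) x = if g = w * s * w⁻¹ then act V w x else 0 := by
  have h : act V w x = V.ρ (e ω (w * s * w⁻¹) w) x := by
    conv_lhs => rw [← hx]
    rw [act, ← ρ_mul_apply, grp_mul_e_one]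
  rw [h]
  split_ifs with hg
  · rw [hg]
  · rw [← hx, ← ρ_mul_apply, e_mul_e_one, if_neg, map_zero, LinearMap.zero_apply]
    rintro rfl
    exact hg (by group)

theorem IsDeg.ρ_e_one {s : G} {x : V.V} (hx : IsDeg V s x) (g : G) :
    V.ρ (e ω g 1) x = if g = s then x else 0 := by
  simp [hx.ρ_e, act_one]

theorem isDeg_ρ_e (g w : G) (x : V.V) : IsDeg V g (V.ρ (e ω g w) x) := by
  rw [IsDeg, ← ρ_mul_apply, e_one_mul_e, if_pos rfl]

theorem IsDeg.act {s : G} {x : V.V} (hx : IsDeg V s x) (w : G) :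
    IsDeg V (w * s * w⁻¹) (act V w x) := by
  have h := isDeg_ρ_e (w * s * w⁻¹) w x
  rwa [hx.ρ_e, if_pos rfl] at h

theorem IsDeg.smul {s : G} {x : V.V} (hx : IsDeg V s x) (c : k) : IsDeg V s (c • x) := by
  rw [IsDeg, map_smul, hx]

/-- The elements `∑_g e_g # w` act projectively on homogeneous vectors, with multiplier `θ`. -/
theorem IsDeg.act_act {s : G} {x : V.V} (hx : IsDeg V s x) (w w' : G) :
    TwistedDouble.act V w (TwistedDouble.act V w' x) =
      (ω.θ (w * w' * s * (w * w')⁻¹) w w' : k) • TwistedDouble.act V (w * w') x := by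
  have h := (hx.act w').ρ_e (w * w' * s * (w * w')⁻¹) w
  rw [if_pos (by group)] at h
  rw [← h]
  have h' := hx.ρ_e (w' * s * w'⁻¹) w'
  rw [if_pos rfl] at h'
  rw [← h', ← ρ_mul_apply, e_mul_e, if_pos (by group), map_smul, LinearMap.smul_apply, hx.ρ_e,
    if_pos rfl]

theorem sum_ρ_e_one (x : V.V) : ∑ s, V.ρ (e ω s 1) x = x := by
  rw [← LinearMap.sum_apply, ← map_sum, ← one_def, map_one, Module.End.one_apply]

theorem tensorAct_comul_e {s t : G} {x : V.V} {y : W.V} (hx : IsDeg V s x) (hy : IsDeg W t y)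
    (g w : G) : tensorAct V.ρ W.ρ (comul ω (e ω g w)) (x ⊗ₜ y) =
      if g = w * s * t * w⁻¹ then (ω.γ w (w * s * w⁻¹) (w * t * w⁻¹) : k) •
        (act V w x ⊗ₜ[k] act W w y) else 0 := by
  rw [comul_e, map_sum, LinearMap.sum_apply, Finset.sum_eq_single (w * s * w⁻¹)]
  · rw [map_smul, LinearMap.smul_apply, tensorAct_tmul, hx.ρ_e, if_pos rfl, hy.ρ_e]
    by_cases hg : g = w * s * t * w⁻¹
    · have : (w * s * w⁻¹)⁻¹ * g = w * t * w⁻¹ := by rw [hg]; group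
      rw [if_pos hg, if_pos this, this]
    · rw [if_neg hg, if_neg, TensorProduct.tmul_zero, smul_zero]
      intro h
      apply hg
      rw [inv_mul_eq_iff_eq_mul] at h
      rw [h]
      group
  · intro u _ hu
    rw [map_smul, LinearMap.smul_apply, tensorAct_tmul, hx.ρ_e, if_neg hu, TensorProduct.zero_tmul,
      smul_zero]
  · simp

theorem tensorAct_comul_grp {s t : G} {x : V.V} {y : W.V} (hx : IsDeg V s x) (hy : IsDeg W t y)
    (w : G) : tensorAct V.ρ W.ρ (comul ω (grp ω w)) (x ⊗ₜ y) =
      (ω.γ w (w * s * w⁻¹) (w * t * w⁻¹) : k) • (act V w x ⊗ₜ[k] act W w y) := by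
  rw [grp, map_sum, map_sum, LinearMap.sum_apply]
  simp [tensorAct_comul_e hx hy]

theorem act_tmul {s t : G} {x : V.V} {y : W.V} (hx : IsDeg V s x) (hy : IsDeg W t y)
    (w : G) : act (tensor V W) w (x ⊗ₜ[k] y : V.V ⊗[k] W.V) =
      (ω.γ w (w * s * w⁻¹) (w * t * w⁻¹) : k) • (act V w x ⊗ₜ[k] act W w y) :=
  tensorAct_comul_grp hx hy w

theorem IsDeg.tmul {s t : G} {x : V.V} {y : W.V} (hx : IsDeg V s x) (hy : IsDeg W t y) :
    IsDeg (tensor V W) (s * t) (x ⊗ₜ[k] y : V.V ⊗[k] W.V) := by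
  have h := tensorAct_comul_e hx hy (s * t) 1
  rw [if_pos (by group), ω.γ_one, act_one, act_one, Units.val_one, one_smul] at h
  exact h

theorem tensorAct_comul_e_one {s : G} {x : V.V} (hx : IsDeg V s x) (g : G) (y : W.V) :
    tensorAct V.ρ W.ρ (comul ω (e ω g 1)) (x ⊗ₜ y) = x ⊗ₜ W.ρ (e ω (s⁻¹ * g) 1) y := by
  rw [comul_e_one, map_sum, LinearMap.sum_apply, Finset.sum_eq_single s]
  · rw [tensorAct_tmul, hx]
  · intro t _ ht
    rw [tensorAct_tmul, hx.ρ_e_one, if_neg ht, TensorProduct.zero_tmul]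
  · simp

/-- The associator is diagonal in the idempotents `e_g # 1`, so homogeneous vectors are reassociated
up to one scalar. -/
theorem associatorEquiv_tmul {s t r : G} {x : V.V} {y : W.V} {z : Z.V} (hx : IsDeg V s x)
    (hy : IsDeg W t y) (hz : IsDeg Z r z) :
    associatorEquiv V W Z ((x ⊗ₜ y) ⊗ₜ z) =
      (((ω s t r)⁻¹ : kˣ) : k) • (x ⊗ₜ[k] (y ⊗ₜ[k] z)) := by
  rw [associatorEquiv_apply, TensorProduct.assoc_tmul]
  change tensorAct V.ρ (tensorAct W.ρ Z.ρ) (diag ω fun a b c => (((ω a b c)⁻¹ : kˣ) : k)) _ = _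
  simp only [diag, map_sum, LinearMap.sum_apply, map_smul, LinearMap.smul_apply, tensorAct_tmul,
    hx.ρ_e_one, hy.ρ_e_one, hz.ρ_e_one]
  rw [Finset.sum_eq_single s, Finset.sum_eq_single t, Finset.sum_eq_single r]
  · simp
  all_goals simp +contextual

/-! ### The regular representation -/

/-- The element `e_g # 1` of the regular representation. -/
noncomputable def regE (g : G) : (regular k (TwistedDouble ω)).V :=
  (regularEquiv k (TwistedDouble ω)).symm (e ω g 1)

theorem isDeg_regE (g : G) : IsDeg (regular k (TwistedDouble ω)) g (regE g) := by
  apply (regularEquiv k (TwistedDouble ω)).injective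
  rw [regularEquiv_ρ, regE, LinearEquiv.apply_symm_apply, e_one_mul_e, if_pos rfl]

theorem regularEquiv_act_regE (a g : G) :
    regularEquiv k (TwistedDouble ω) (act _ a (regE g)) = e ω (a * g * a⁻¹) a := by
  rw [act, regularEquiv_ρ, regE, LinearEquiv.apply_symm_apply, grp_mul_e_one]

/-- The vectors `a · (e_g # 1) = e_{aga⁻¹} # a` are distinct basis elements, so coefficients can be
compared. This extracts each relation among the `T_{h,a}` from an identity of half-braidings. -/
theorem sum_act_regE_tmul_injective {M : Type*} [AddCommGroup M] [Module k M] (g : G)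
    {z z' : G → M} (h : ∑ a, act (regular k (TwistedDouble ω)) a (regE g) ⊗ₜ[k] z a =
      ∑ a, act (regular k (TwistedDouble ω)) a (regE g) ⊗ₜ[k] z' a) (a : G) : z a = z' a := by
  have key : ∀ z : G → M, TensorProduct.lid k M (TensorProduct.map
      ((basis ω).coord (a * g * a⁻¹, a) ∘ₗ (regularEquiv k (TwistedDouble ω)).toLinearMap)
      LinearMap.id (∑ a, act (regular k (TwistedDouble ω)) a (regE g) ⊗ₜ[k] z a)) = z a := by
    intro z
    simp only [map_sum, TensorProduct.map_tmul, LinearMap.comp_apply, LinearEquiv.coe_coe,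
      regularEquiv_act_regE, TensorProduct.lid_tmul, LinearMap.id_apply]
    rw [Finset.sum_eq_single a]
    · simp [e]
    · intro b _ hb
      simp [e, Finsupp.single_apply, hb]
    · simp
  rw [← key z, h, key]

end TwistedDouble

namespace TwistedDouble

open FDModule

variable {G : Type v} {k : Type u} [Group G] [Field k] {ω : NormalizedThreeCocycle G k}
  [Fintype G] [DecidableEq G]

/-! ### The coefficients of a half-braiding -/

/-- The coefficients `T_{h,a}` of a half-braiding `x ⊗ y ↦ ∑ (e_h # a) y ⊗ T_{h,a} x`. -/
noncomputable def coef (X : Center (FDModule k (TwistedDouble ω))) (h a : G) : Module.End k X.1.V :=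
  (TensorProduct.lid k X.1.V).toLinearMap ∘ₗ
    TensorProduct.map ((basis ω).coord (h, a)) LinearMap.id ∘ₗ coact X

variable {X Y : Center (FDModule k (TwistedDouble ω))} {V W : FDModule k (TwistedDouble ω)}

theorem eq_smul_of_smul_eq {M : Type*} [AddCommGroup M] [Module k M] {c d : kˣ} {x y : M}
    (h : (c : k) • x = (d : k) • y) : x = ((d / c : kˣ) : k) • y := by
  rw [div_eq_inv_mul, Units.val_mul, mul_smul, ← h, smul_smul, ← Units.val_mul, inv_mul_cancel,
    Units.val_one, one_smul]

theorem coact_eq_sum (x : X.1.V) : coact X x = ∑ h, ∑ a, e ω h a ⊗ₜ[k] coef X h a x := by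
  have key : ∀ z : TwistedDouble ω ⊗[k] X.1.V, z = ∑ p : G × G, basis ω p ⊗ₜ[k]
      TensorProduct.lid k X.1.V (TensorProduct.map ((basis ω).coord p) LinearMap.id z) := by
    intro z
    induction z with
    | zero => simp
    | add z z' hz hz' =>
      conv_lhs => rw [hz, hz']
      simp only [map_add, TensorProduct.tmul_add, Finset.sum_add_distrib]
    | tmul h x =>
      conv_lhs => rw [← (basis ω).sum_repr h, TensorProduct.sum_tmul]
      simp [TensorProduct.smul_tmul]
  rw [key (coact X x), Fintype.sum_prod_type]
  rfl

theorem halfBraid_eq_sum (x : X.1.V) (y : V.V) :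
    halfBraid X V (x ⊗ₜ y) = ∑ h, ∑ a, V.ρ (e ω h a) y ⊗ₜ[k] coef X h a x := by
  rw [halfBraid_tmul, coact_eq_sum]
  simp only [map_sum, TensorProduct.map_tmul, evalAt_apply, LinearMap.id_apply]

theorem halfBraid_of_deg {g : G} {y : V.V} (hy : IsDeg V g y) (x : X.1.V) :
    halfBraid X V (x ⊗ₜ y) = ∑ a, act V a y ⊗ₜ[k] coef X (a * g * a⁻¹) a x := by
  rw [halfBraid_eq_sum, Finset.sum_comm]
  refine Finset.sum_congr rfl fun a _ => ?_
  simp only [hy.ρ_e]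
  rw [Finset.sum_eq_single (a * g * a⁻¹)]
  · rw [if_pos rfl]
  · intro h _ hh
    rw [if_neg hh, TensorProduct.zero_tmul]
  · simp

/-- Morphisms of the center commute with half-braidings, hence with their coefficients on the
regular representation. -/
theorem coef_hom {X' : Center (FDModule k (TwistedDouble ω))} (f : X ⟶ X') (h a : G) (x : X.1.V) :
    coef X' h a (f.f.hom x) = f.f.hom (coef X h a x) := by
  have e := halfBraid_hom f (regular k (TwistedDouble ω)) (x ⊗ₜ[k] regE (a⁻¹ * h * a))
  rw [TensorProduct.map_tmul, LinearMap.id_apply, halfBraid_of_deg (isDeg_regE _),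
    halfBraid_of_deg (isDeg_regE _), map_sum] at e
  simp only [TensorProduct.map_tmul, LinearMap.id_apply] at e
  have e' := sum_act_regE_tmul_injective _ e a
  have ha : a * (a⁻¹ * h * a) * a⁻¹ = h := by group
  rwa [ha] at e'

/-- The half-braiding commutes with `e_g # 1`, so it preserves total degree. With `l = a⁻¹ha`, the
total degree `s l` before braiding equals `h` times the degree of `T_{h,a} x` after it. -/
theorem IsDeg.coef {s : G} {x : X.1.V} (hx : IsDeg X.1 s x) (h a : G) :
    IsDeg X.1 (h⁻¹ * s * (a⁻¹ * h * a)) (coef X h a x) := by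
  set l := a⁻¹ * h * a with hl
  have ha : a * l * a⁻¹ = h := by rw [hl]; group
  have e1 := halfBraid_ρ X (regular k (TwistedDouble ω)) (e ω (s * l) 1) (x ⊗ₜ[k] regE l)
  change halfBraid X _ (tensorAct _ _ (comul ω _) _) = tensorAct _ _ (comul ω _) _ at e1
  rw [tensorAct_comul_e hx (isDeg_regE l), if_pos (by group), act_one, act_one, ω.γ_one,
    Units.val_one, one_smul, halfBraid_of_deg (isDeg_regE l), map_sum] at e1
  simp only [tensorAct_comul_e_one ((isDeg_regE l).act _)] at e1
  have e' := sum_act_regE_tmul_injective _ e1 a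
  rw [ha, ← mul_assoc] at e'
  exact e'.symm

theorem eq_of_sum_act_regE_tmul {M : Type*} [AddCommGroup M] [Module k M] (g : G)
    (σ τ : Equiv.Perm G) {z z' : G → M}
    (h : ∑ a, act (regular k (TwistedDouble ω)) (σ a) (regE g) ⊗ₜ[k] z a =
      ∑ a, act (regular k (TwistedDouble ω)) (τ a) (regE g) ⊗ₜ[k] z' a) {a b : G}
    (hab : σ a = τ b) : z a = z' b := by
  have key : ∀ (σ : Equiv.Perm G) (z : G → M),
      ∑ a, act (regular k (TwistedDouble ω)) (σ a) (regE g) ⊗ₜ[k] z a =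
      ∑ a, act (regular k (TwistedDouble ω)) a (regE g) ⊗ₜ[k] z (σ.symm a) := fun σ z =>
    Fintype.sum_equiv σ _ _ fun a => by rw [σ.symm_apply_apply]
  rw [key, key] at h
  have := sum_act_regE_tmul_injective g h (σ a)
  rwa [σ.symm_apply_apply, hab, τ.symm_apply_apply] at this

/-- Linearity of the half-braiding under `∑_g e_g # w`, read off on the regular representation. The
scalar collects the `γ` and `θ` arising on the two sides. -/
theorem coef_act {s : G} {x : X.1.V} (hx : IsDeg X.1 s x) (w h a : G) :
    coef X (w * h * w⁻¹) (w * a * w⁻¹) (act X.1 w x) =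
      (ω.linScalar w s h a : k) • act X.1 w (coef X h a x) := by
  set l := a⁻¹ * h * a with hl
  have ha : a * l * a⁻¹ = h := by rw [hl]; group
  have hy := isDeg_regE (ω := ω) l
  have e1 := halfBraid_ρ X (regular k (TwistedDouble ω)) (grp ω w) (x ⊗ₜ[k] regE l)
  change halfBraid X _ (tensorAct _ _ (comul ω _) _) = tensorAct _ _ (comul ω _) _ at e1
  rw [tensorAct_comul_grp hx hy, map_smul, halfBraid_of_deg (hy.act w), halfBraid_of_deg hy,
    map_sum, Finset.smul_sum] at e1
  have e2 : ∀ b, tensorAct (regular k (TwistedDouble ω)).ρ X.1.ρ (comul ω (grp ω w))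
      (act (regular k (TwistedDouble ω)) b (regE l) ⊗ₜ[k] coef X (b * l * b⁻¹) b x) =
      act (regular k (TwistedDouble ω)) (w * b) (regE l) ⊗ₜ[k]
        (((ω.γ w (w * (b * l * b⁻¹) * w⁻¹)
            (w * ((b * l * b⁻¹)⁻¹ * s * (b⁻¹ * (b * l * b⁻¹) * b)) * w⁻¹) *
          ω.θ (w * b * l * (w * b)⁻¹) w b : kˣ) : k) • act X.1 w (coef X (b * l * b⁻¹) b x)) := by
    intro b
    rw [tensorAct_comul_grp (hy.act b) (hx.coef _ b), hy.act_act, ← TensorProduct.smul_tmul',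
      smul_smul, TensorProduct.tmul_smul, Units.val_mul]
  have e3 : ∀ b, (ω.γ w (w * s * w⁻¹) (w * l * w⁻¹) : k) •
      (act (regular k (TwistedDouble ω)) b (act (regular k (TwistedDouble ω)) w (regE l)) ⊗ₜ[k]
        coef X (b * (w * l * w⁻¹) * b⁻¹) b (act X.1 w x)) =
      act (regular k (TwistedDouble ω)) (b * w) (regE l) ⊗ₜ[k]
        (((ω.γ w (w * s * w⁻¹) (w * l * w⁻¹) * ω.θ (b * w * l * (b * w)⁻¹) b w : kˣ) : k) •
          coef X (b * (w * l * w⁻¹) * b⁻¹) b (act X.1 w x)) := by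
    intro b
    rw [hy.act_act, ← TensorProduct.smul_tmul', smul_smul, TensorProduct.tmul_smul, Units.val_mul]
  rw [Finset.sum_congr rfl fun b _ => e2 b, Finset.sum_congr rfl fun b _ => e3 b] at e1
  -- One side is indexed by `bw`, the other by `wb`; the indices `waw⁻¹` and `a` both give the basis
  -- element labelled `wa`.
  have e' := eq_of_sum_act_regE_tmul l (Equiv.mulRight w) (Equiv.mulLeft w) e1
    (a := w * a * w⁻¹) (b := a) (by simp)
  simp only [ha] at e'
  have w1 : w * a * w⁻¹ * (w * l * w⁻¹) * (w * a * w⁻¹)⁻¹ = w * h * w⁻¹ := by rw [← ha]; group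
  have w2 : w * a * l * (w * a)⁻¹ = w * h * w⁻¹ := by rw [← ha]; group
  rw [w1, inv_mul_cancel_right, w2] at e'
  exact eq_smul_of_smul_eq e'

/-- The half-braiding with a tensor product. -/
noncomputable def halfBraid₂ (X : Center (FDModule k (TwistedDouble ω)))
    (V W : FDModule k (TwistedDouble ω)) :
    X.1.V ⊗[k] (V.V ⊗[k] W.V) →ₗ[k] (V.V ⊗[k] W.V) ⊗[k] X.1.V :=
  halfBraid X (tensor V W)

theorem halfBraid₂_of_deg {g m : G} {y : V.V} {z : W.V} (hy : IsDeg V g y) (hz : IsDeg W m z)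
    (x : X.1.V) : halfBraid₂ X V W (x ⊗ₜ (y ⊗ₜ z)) =
      ∑ a, (ω.γ a (a * g * a⁻¹) (a * m * a⁻¹) : k) •
        ((act V a y ⊗ₜ[k] act W a z) ⊗ₜ[k] coef X (a * (g * m) * a⁻¹) a x) := by
  refine (halfBraid_of_deg (hy.tmul hz) x).trans (Finset.sum_congr rfl fun a _ => ?_)
  rw [act_tmul hy hz]
  rfl

/-- The hexagon on two copies of the regular representation. Braiding past a tensor product uses the
same group element on both factors, whereas braiding successively allows two labels `a`, `b`. The
mixed terms must therefore vanish. -/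
theorem coef_coef {s : G} {x : X.1.V} (hx : IsDeg X.1 s x) (h l a b : G) :
    coef X l b (coef X h a x) =
      if b = a then (ω.hexScalar h l s a : k) • coef X (h * l) a x else 0 := by
  set g := a⁻¹ * h * a with hg
  set m := b⁻¹ * l * b with hm
  have ha : a * g * a⁻¹ = h := by rw [hg]; group
  have hb : b * m * b⁻¹ = l := by rw [hm]; group
  have hy := isDeg_regE (ω := ω) g
  have hz := isDeg_regE (ω := ω) m
  have e1 : associatorEquiv _ _ X.1 (halfBraid₂ X _ _ (associatorEquiv X.1 _ _ _)) = _ :=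
    halfBraid_tensor X (regular k (TwistedDouble ω)) (regular k (TwistedDouble ω))
      ((x ⊗ₜ[k] regE g) ⊗ₜ[k] regE m)
  rw [associatorEquiv_tmul hx hy hz, map_smul, map_smul, halfBraid₂_of_deg hy hz,
    TensorProduct.map_tmul, halfBraid_of_deg hy, LinearMap.id_apply, TensorProduct.sum_tmul,
    map_sum, map_sum, map_sum, Finset.smul_sum] at e1
  have e2 : ∀ c, (((ω s g m)⁻¹ : kˣ) : k) • associatorEquiv (regular k (TwistedDouble ω))
      (regular k (TwistedDouble ω)) X.1 ((ω.γ c (c * g * c⁻¹) (c * m * c⁻¹) : k) •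
        ((act (regular k (TwistedDouble ω)) c (regE g) ⊗ₜ[k]
          act (regular k (TwistedDouble ω)) c (regE m)) ⊗ₜ[k] coef X (c * (g * m) * c⁻¹) c x)) =
      act (regular k (TwistedDouble ω)) c (regE g) ⊗ₜ[k]
        ((((ω s g m)⁻¹ * (ω.γ c (c * g * c⁻¹) (c * m * c⁻¹) * (ω (c * g * c⁻¹) (c * m * c⁻¹)
          ((c * (g * m) * c⁻¹)⁻¹ * s * (c⁻¹ * (c * (g * m) * c⁻¹) * c)))⁻¹) : kˣ) : k) •
          (act (regular k (TwistedDouble ω)) c (regE m) ⊗ₜ[k]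
            coef X (c * (g * m) * c⁻¹) c x)) := by
    intro c
    rw [map_smul, associatorEquiv_tmul (hy.act c) (hz.act c) (hx.coef _ c), smul_smul, smul_smul,
      TensorProduct.tmul_smul, ← Units.val_mul, ← Units.val_mul, mul_assoc]
  have e3 : ∀ c, TensorProduct.map LinearMap.id (halfBraid X (regular k (TwistedDouble ω)))
      (associatorEquiv (regular k (TwistedDouble ω)) X.1 (regular k (TwistedDouble ω))
        ((act (regular k (TwistedDouble ω)) c (regE g) ⊗ₜ[k] coef X (c * g * c⁻¹) c x) ⊗ₜ[k]
          regE m)) =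
      act (regular k (TwistedDouble ω)) c (regE g) ⊗ₜ[k]
        ((((ω (c * g * c⁻¹) ((c * g * c⁻¹)⁻¹ * s * (c⁻¹ * (c * g * c⁻¹) * c)) m)⁻¹ : kˣ) : k) •
          ∑ d, act (regular k (TwistedDouble ω)) d (regE m) ⊗ₜ[k]
            coef X (d * m * d⁻¹) d (coef X (c * g * c⁻¹) c x)) := by
    intro c
    rw [associatorEquiv_tmul (hy.act c) (hx.coef _ c) hz, map_smul, TensorProduct.map_tmul,
      LinearMap.id_apply, halfBraid_of_deg hz, TensorProduct.tmul_smul]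
  rw [Finset.sum_congr rfl fun c _ => e2 c, Finset.sum_congr rfl fun c _ => e3 c] at e1
  have e4 := sum_act_regE_tmul_injective g e1 a
  rw [Finset.smul_sum] at e4
  -- A single term is rewritten as a sum supported at `d = a`, so that coefficients can be compared
  -- in the second factor as well.
  have e5 : ∀ (c : k) (v : X.1.V), c • (act (regular k (TwistedDouble ω)) a (regE m) ⊗ₜ[k] v) =
      ∑ d, act (regular k (TwistedDouble ω)) d (regE m) ⊗ₜ[k] (if d = a then c • v else 0) := by
    intro c v
    rw [Finset.sum_eq_single a]
    · rw [if_pos rfl, TensorProduct.tmul_smul]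
    · intro d _ hd
      rw [if_neg hd, TensorProduct.tmul_zero]
    · simp
  rw [e5] at e4
  simp only [← TensorProduct.tmul_smul] at e4
  have e6 := sum_act_regE_tmul_injective m e4 b
  rw [ha, hb] at e6
  split_ifs at e6 ⊢ with hba
  · subst hba
    have w1 : b * (g * m) * b⁻¹ = h * l := by rw [← ha, ← hb]; group
    rw [w1, hb] at e6
    rw [eq_smul_of_smul_eq e6.symm]
    congr 2
    rw [NormalizedThreeCocycle.hexScalar, ← hg, ← hm]
    have w2 : (h * l)⁻¹ * s * (b⁻¹ * (h * l) * b) = l⁻¹ * (h⁻¹ * s * g) * m := by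
      rw [hg, hm]; group
    rw [w2, div_inv_eq_mul, div_eq_mul_inv, mul_inv]
    simp only [mul_comm, mul_left_comm, mul_assoc]
  · exact (smul_eq_zero.mp e6.symm).resolve_left (Units.ne_zero _)

end TwistedDouble

/-! ### Scalars at the identity element -/

namespace NormalizedThreeCocycle

variable {G : Type v} {k : Type u} [Group G] [Field k] (ω : NormalizedThreeCocycle G k)

theorem hexScalar_one_right (h s a : G) : ω.hexScalar h 1 s a = 1 := by
  simp [hexScalar, map_one_left, map_one_mid, map_one_right, γ_one_right]

theorem linScalar_one (w s a : G) : ω.linScalar w s 1 a = 1 := by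
  simp [linScalar, θ, γ_one_left, γ_one_right, map_one_left, map_one_mid, map_one_right, mul_assoc]

end NormalizedThreeCocycle

namespace TwistedDouble

open FDModule

variable {G : Type v} {k : Type u} [Group G] [Field k] {ω : NormalizedThreeCocycle G k}
  [Fintype G] [DecidableEq G] {X Y : Center (FDModule k (TwistedDouble ω))}
  {V W : FDModule k (TwistedDouble ω)}

/-! ### Bihomogeneous vectors -/

theorem linearMap_ext_of_deg {M : Type*} [AddCommGroup M] [Module k M] {f f' : V.V →ₗ[k] M}
    (h : ∀ s x, IsDeg V s x → f x = f' x) : f = f' := by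
  ext x
  rw [← sum_ρ_e_one x, map_sum, map_sum]
  exact Finset.sum_congr rfl fun s _ => h s _ (isDeg_ρ_e s 1 x)

theorem coef_one_coef (h a b : G) (x : X.1.V) :
    coef X 1 b (coef X h a x) = if b = a then coef X h a x else 0 := by
  have key : coef X 1 b ∘ₗ coef X h a = if b = a then coef X h a else 0 := by
    refine linearMap_ext_of_deg fun s x hx => ?_
    rw [LinearMap.comp_apply, coef_coef hx, ω.hexScalar_one_right, mul_one, Units.val_one, one_smul]
    split_ifs <;> rfl
  have := LinearMap.congr_fun key x
  rw [LinearMap.comp_apply] at this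
  rw [this]
  split_ifs <;> rfl

theorem isDeg_unit (c : k) : IsDeg (unit : FDModule k (TwistedDouble ω)) (1 : G) c := by
  change counit ω (e ω 1 1) * c = c
  rw [counit_e, if_pos rfl, one_mul]

theorem act_unit (w : G) (c : k) : act (unit : FDModule k (TwistedDouble ω)) w c = c := by
  change counit ω (grp ω w) * c = c
  simp [grp, counit_e]

/-- Braiding with the unit object applies `P = ∑ T_{1,a}`. By orthogonality `P` is idempotent, and
it is injective because the half-braiding is, so `P = 1`. -/
theorem sum_coef_one (x : X.1.V) : ∑ a, coef X 1 a x = x := by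
  have h : ∀ x : X.1.V, halfBraid X unit (x ⊗ₜ[k] (1 : k)) = (1 : k) ⊗ₜ[k] ∑ a, coef X 1 a x := by
    intro x
    rw [TensorProduct.tmul_sum]
    refine (halfBraid_of_deg (isDeg_unit (ω := ω) (1 : k)) x).trans
      (Finset.sum_congr rfl fun a _ => ?_)
    rw [mul_one, mul_inv_cancel]
    exact congrArg (· ⊗ₜ[k] _) (act_unit a 1)
  have h' : ∑ b, coef X 1 b (∑ a, coef X 1 a x) = ∑ a, coef X 1 a x := by
    simp [map_sum, coef_one_coef]
  have e := halfBraid_injective X unit ((h _).trans ((congrArg _ h').trans (h x).symm))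
  exact (TensorProduct.rid k X.1.V).symm.injective e

/-- Vectors `x` of degree `s` whose half-braiding is `x ⊗ y ↦ ∑ (e_h # a) y ⊗ T_{h,a} x` with the
given `a`. -/
structure IsHomog (X : Center (FDModule k (TwistedDouble ω))) (s a : G) (x : X.1.V) : Prop where
  deg : IsDeg X.1 s x
  coef_one : coef X 1 a x = x

/-- The idempotents `T_{1,a}` preserve degree, so the two decompositions are compatible and
bihomogeneous vectors span. -/
theorem linearMap_ext_of_homog {M : Type*} [AddCommGroup M] [Module k M] {f f' : X.1.V →ₗ[k] M}
    (h : ∀ s a x, IsHomog X s a x → f x = f' x) : f = f' := by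
  refine linearMap_ext_of_deg fun s x hx => ?_
  rw [← sum_coef_one x, map_sum, map_sum]
  refine Finset.sum_congr rfl fun a _ => h s a _ ⟨?_, ?_⟩
  · simpa using hx.coef 1 a
  · rw [coef_one_coef, if_pos rfl]

namespace IsHomog

variable {s t a b : G} {x : X.1.V} {y : Y.1.V}

theorem coef_of_ne (hx : IsHomog X s a x) {c : G} (hc : c ≠ a) (h : G) :
    TwistedDouble.coef X h c x = 0 := by
  rw [← hx.coef_one, coef_coef hx.deg, if_neg hc]

theorem coef_coef (hx : IsHomog X s a x) (h l : G) :
    TwistedDouble.coef X l a (TwistedDouble.coef X h a x) =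
      (ω.hexScalar h l s a : k) • TwistedDouble.coef X (h * l) a x := by
  rw [TwistedDouble.coef_coef hx.deg, if_pos rfl]

theorem coef (hx : IsHomog X s a x) (h : G) :
    IsHomog X (h⁻¹ * s * (a⁻¹ * h * a)) a (TwistedDouble.coef X h a x) :=
  ⟨hx.deg.coef h a, by rw [coef_one_coef, if_pos rfl]⟩

theorem act (hx : IsHomog X s a x) (w : G) :
    IsHomog X (w * s * w⁻¹) (w * a * w⁻¹) (TwistedDouble.act X.1 w x) := by
  refine ⟨hx.deg.act w, ?_⟩
  have h := coef_act hx.deg w 1 a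
  rw [mul_one, mul_inv_cancel, hx.coef_one] at h
  rw [h, ω.linScalar_one, Units.val_one, one_smul]

theorem smul (hx : IsHomog X s a x) (c : k) : IsHomog X s a (c • x) :=
  ⟨hx.deg.smul c, by rw [map_smul, hx.coef_one]⟩

theorem halfBraid_tmul (hx : IsHomog X s a x) {g : G} {v : V.V} (hv : IsDeg V g v) :
    halfBraid X V (x ⊗ₜ v) =
      TwistedDouble.act V a v ⊗ₜ[k] TwistedDouble.coef X (a * g * a⁻¹) a x := by
  rw [halfBraid_of_deg hv, Finset.sum_eq_single a]
  · intro c _ hc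
    rw [hx.coef_of_ne hc, TensorProduct.tmul_zero]
  · simp

end IsHomog

/-! ### The twist of an object of the center -/

/-- The action of the twist, `x ↦ ∑ (e_h # a) T_{h,a} x`. -/
noncomputable def twist (X : Center (FDModule k (TwistedDouble ω))) : Module.End k X.1.V :=
  ∑ h, ∑ a, X.1.ρ (e ω h a) ∘ₗ coef X h a

theorem twist_hom {X' : Center (FDModule k (TwistedDouble ω))} (f : X ⟶ X') (x : X.1.V) :
    twist X' (f.f.hom x) = f.f.hom (twist X x) := by
  simp only [twist, LinearMap.sum_apply, LinearMap.comp_apply, coef_hom, map_sum]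
  refine Finset.sum_congr rfl fun h _ => Finset.sum_congr rfl fun a _ => ?_
  exact (f.f.comm _ _).symm

/-- The vector `T_{h,a} x` has degree `h⁻¹ s (a⁻¹ha)`, while `e_h # a` detects degree `a⁻¹ha`; these
agree only for `h = s`. -/
theorem IsHomog.twist {s a : G} {x : X.1.V} (hx : IsHomog X s a x) :
    twist X x = TwistedDouble.act X.1 a (TwistedDouble.coef X s a x) := by
  simp only [TwistedDouble.twist, LinearMap.sum_apply, LinearMap.comp_apply]
  rw [Finset.sum_eq_single s, Finset.sum_eq_single a]
  · rw [(hx.coef s).deg.ρ_e, if_pos (by group)]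
  · intro c _ hc
    rw [hx.coef_of_ne hc, map_zero]
  · simp
  · intro h _ hh
    refine Finset.sum_eq_zero fun c _ => ?_
    by_cases hc : c = a
    · subst hc
      rw [(hx.coef h).deg.ρ_e, if_neg]
      intro h'
      apply hh
      have := congrArg (fun g => c⁻¹ * g * h⁻¹ * c) h'
      exact inv_mul_eq_one.mp (by simpa [mul_assoc] using this.symm)
    · rw [hx.coef_of_ne hc, map_zero]
  · simp

end TwistedDouble

namespace NormalizedThreeCocycle

theorem tensorScalar_one {G : Type v} {k : Type u} [Group G] [Field k]
    (ω : NormalizedThreeCocycle G k) (s t a b : G) : ω.tensorScalar s t 1 a b = 1 := by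
  simp [tensorScalar, θ, map_one_left, map_one_mid, map_one_right]

end NormalizedThreeCocycle

namespace TwistedDouble

open FDModule

variable {G : Type v} {k : Type u} [Group G] [Field k] {ω : NormalizedThreeCocycle G k}
  [Fintype G] [DecidableEq G] {X Y : Center (FDModule k (TwistedDouble ω))}
  {V W : FDModule k (TwistedDouble ω)} {s t a b : G} {x : X.1.V} {y : Y.1.V}

theorem eq_ite_of_sum_act_regE_tmul {M : Type*} [AddCommGroup M] [Module k M] {g d : G}
    {z : G → M} {m : M} (h : ∑ a, act (regular k (TwistedDouble ω)) a (regE g) ⊗ₜ[k] z a =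
      act (regular k (TwistedDouble ω)) d (regE g) ⊗ₜ[k] m) (a : G) :
    z a = if a = d then m else 0 := by
  refine sum_act_regE_tmul_injective g (z' := fun a => if a = d then m else 0) (h.trans ?_) a
  rw [Finset.sum_eq_single d]
  · rw [if_pos rfl]
  · intro c _ hc
    rw [if_neg hc, TensorProduct.tmul_zero]
  · simp

/-! ### Tensor products of objects of the center -/

/-- The coefficients of the half-braiding of a tensor product. -/
noncomputable def coef₂ (X Y : Center (FDModule k (TwistedDouble ω))) (h a : G) :
    Module.End k (X.1.V ⊗[k] Y.1.V) := coef (X ⊗ Y) h a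

/-- On bihomogeneous vectors each half-braiding is a single tensor, so braiding past `y` and then
past `x` gives a single tensor again. Labels multiply, and the three reassociations together with
`θ` produce `tensorScalar`. -/
theorem halfBraid_tmul_tmul (hx : IsHomog X s a x) (hy : IsHomog Y t b y) {l : G} {v : V.V}
    (hv : IsDeg V l v) : halfBraid (X ⊗ Y) V ((x ⊗ₜ[k] y : X.1.V ⊗[k] Y.1.V) ⊗ₜ[k] v) =
      act V (a * b) v ⊗ₜ[k] ((ω.tensorScalar s t (a * b * l * (a * b)⁻¹) a b : k) •
        (coef X (a * b * l * (a * b)⁻¹) a x ⊗ₜ[k] coef Y (b * l * b⁻¹) b y)) := by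
  -- An explicit preimage under the associator, with the scalar chosen to match, replaces the
  -- inverse associator in the half-braiding of `X ⊗ Y`.
  have e1 : associatorEquiv X.1 V Y.1 (((ω s (b * l * b⁻¹)
      ((b * l * b⁻¹)⁻¹ * t * (b⁻¹ * (b * l * b⁻¹) * b)) / ω s t l : kˣ) : k) •
        ((x ⊗ₜ act V b v) ⊗ₜ coef Y (b * l * b⁻¹) b y)) =
      TensorProduct.map LinearMap.id (halfBraid Y V) (associatorEquiv X.1 Y.1 V
        ((x ⊗ₜ y) ⊗ₜ v)) := by
    rw [associatorEquiv_tmul hx.deg hy.deg hv, map_smul, map_smul, TensorProduct.map_tmul,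
      hy.halfBraid_tmul hv, associatorEquiv_tmul hx.deg (hv.act b) (hy.coef _).deg, smul_smul,
      ← Units.val_mul, LinearMap.id_apply]
    congr 2
    rw [div_mul_eq_mul_div, mul_inv_cancel, one_div]
  refine (halfBraid_tensorObj X Y V _ _ e1).trans ?_
  rw [map_smul, map_smul, TensorProduct.map_tmul,
    LinearMap.id_apply, hx.halfBraid_tmul (hv.act b),
    associatorEquiv_tmul ((hv.act b).act a) (hx.coef _).deg (hy.coef _).deg, hv.act_act,
    ← TensorProduct.smul_tmul', smul_smul, smul_smul, TensorProduct.tmul_smul]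
  have w1 : a * (b * l * b⁻¹) * a⁻¹ = a * b * l * (a * b)⁻¹ := by group
  rw [w1, ← Units.val_mul, ← Units.val_mul]
  congr 2
  rw [NormalizedThreeCocycle.tensorScalar]
  have w2 : a⁻¹ * (a * b * l * (a * b)⁻¹) * a = b * l * b⁻¹ := by group
  have w3 : b⁻¹ * (b * l * b⁻¹) * b = l := by group
  rw [w2, w3]
  simp only [div_eq_mul_inv, mul_inv]
  simp only [mul_comm, mul_left_comm, mul_assoc]

theorem coef_tmul_aux (hx : IsHomog X s a x) (hy : IsHomog Y t b y) (l c : G) :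
    coef₂ X Y (c * l * c⁻¹) c (x ⊗ₜ y) = if c = a * b then
      (ω.tensorScalar s t (a * b * l * (a * b)⁻¹) a b : k) •
        (coef X (a * b * l * (a * b)⁻¹) a x ⊗ₜ[k] coef Y (b * l * b⁻¹) b y) else 0 := by
  have e1 := halfBraid_tmul_tmul hx hy (isDeg_regE (ω := ω) l)
  have e2 := (halfBraid_of_deg (X := X ⊗ Y) (isDeg_regE (ω := ω) l)
    (x ⊗ₜ[k] y : X.1.V ⊗[k] Y.1.V)).symm.trans e1
  exact eq_ite_of_sum_act_regE_tmul (z := fun c => coef₂ X Y (c * l * c⁻¹) c (x ⊗ₜ y)) e2 c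

theorem IsHomog.coef_tmul (hx : IsHomog X s a x) (hy : IsHomog Y t b y) (h : G) :
    coef₂ X Y h (a * b) (x ⊗ₜ y) = (ω.tensorScalar s t h a b : k) •
      (TwistedDouble.coef X h a x ⊗ₜ[k] TwistedDouble.coef Y (a⁻¹ * h * a) b y) := by
  have e := coef_tmul_aux hx hy ((a * b)⁻¹ * h * (a * b)) (a * b)
  have w1 : a * b * ((a * b)⁻¹ * h * (a * b)) * (a * b)⁻¹ = h := by group
  have w2 : b * ((a * b)⁻¹ * h * (a * b)) * b⁻¹ = a⁻¹ * h * a := by group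
  rwa [w1, w2, if_pos rfl] at e

theorem IsHomog.tmul (hx : IsHomog X s a x) (hy : IsHomog Y t b y) :
    IsHomog (X ⊗ Y) (s * t) (a * b) (x ⊗ₜ[k] y : X.1.V ⊗[k] Y.1.V) := by
  refine ⟨hx.deg.tmul hy.deg, ?_⟩
  have e := hx.coef_tmul hy 1
  rw [ω.tensorScalar_one, Units.val_one, one_smul, mul_one, inv_mul_cancel, hx.coef_one,
    hy.coef_one] at e
  exact e

theorem IsHomog.doubleBraiding_tmul (hx : IsHomog X s a x) (hy : IsHomog Y t b y) :
    doubleBraiding X Y (x ⊗ₜ[k] y : X.1.V ⊗[k] Y.1.V) =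
      (TwistedDouble.act X.1 (a * b * a⁻¹) (TwistedDouble.coef X (a * t * a⁻¹) a x) ⊗ₜ[k]
        TwistedDouble.coef Y (a * b * a⁻¹ * ((a * t * a⁻¹)⁻¹ * s * (a⁻¹ * (a * t * a⁻¹) * a)) *
          (a * b * a⁻¹)⁻¹) (a * b * a⁻¹) (TwistedDouble.act Y.1 a y) : X.1.V ⊗[k] Y.1.V) := by
  rw [doubleBraiding_apply, hx.halfBraid_tmul hy.deg]
  exact (hy.act a).halfBraid_tmul (hx.coef _).deg

end TwistedDouble

namespace TwistedDouble

open FDModule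

variable {G : Type v} {k : Type u} [Group G] [Field k] {ω : NormalizedThreeCocycle G k}
  [Fintype G] [DecidableEq G] {X Y : Center (FDModule k (TwistedDouble ω))}
  {s t a b : G} {x : X.1.V} {y : Y.1.V}

/-! ### Balancing -/

/-- The double braiding as an endomorphism of the tensor product of the underlying spaces. -/
noncomputable def dbl (X Y : Center (FDModule k (TwistedDouble ω))) :
    Module.End k (X.1.V ⊗[k] Y.1.V) := doubleBraiding X Y

/-- The twist of a tensor product. -/
noncomputable def twist₂ (X Y : Center (FDModule k (TwistedDouble ω))) :
    Module.End k (X.1.V ⊗[k] Y.1.V) := twist (X ⊗ Y)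

/-- The left factor of the double braiding after twisting `x`. -/
theorem IsHomog.act_coef_act_coef (hx : IsHomog X s a x) (b t : G) :
    TwistedDouble.act X.1 (a * b * a⁻¹) (TwistedDouble.coef X (a * t * a⁻¹) a
      (TwistedDouble.act X.1 a (TwistedDouble.coef X s a x))) =
      ((ω.linScalar a (a⁻¹ * s * a) t a * ω.hexScalar s t s a *
        ω.θ (a * b * ((s * t)⁻¹ * s * (a⁻¹ * (s * t) * a)) * (a * b)⁻¹) (a * b * a⁻¹) a : kˣ) : k) •
        TwistedDouble.act X.1 (a * b) (TwistedDouble.coef X (s * t) a x) := by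
  have h := coef_act (hx.coef s).deg a t a
  rw [mul_inv_cancel_right, inv_mul_cancel, one_mul] at h
  rw [h, hx.coef_coef, map_smul, map_smul, map_smul, (hx.coef _).deg.act_act, smul_smul, smul_smul,
    inv_mul_cancel_right, Units.val_mul, Units.val_mul, mul_assoc]

/-- The right factor of the double braiding after twisting `y`. -/
theorem IsHomog.coef_act_act_coef (hy : IsHomog Y t b y) (a r : G) :
    TwistedDouble.coef Y (a * b * r * (a * b)⁻¹) (a * b * a⁻¹) (TwistedDouble.act Y.1 a
      (TwistedDouble.act Y.1 b (TwistedDouble.coef Y t b y))) =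
      ((ω.θ (a * t * a⁻¹) a b * ω.linScalar (a * b) (b⁻¹ * t * b) r b *
        ω.hexScalar t r t b : kˣ) : k) •
        TwistedDouble.act Y.1 (a * b) (TwistedDouble.coef Y (t * r) b y) := by
  have h := coef_act (hy.coef t).deg (a * b) r b
  have w1 : a * b * b * (a * b)⁻¹ = a * b * a⁻¹ := by group
  have w2 : a * b * (b⁻¹ * t * b) * (a * b)⁻¹ = a * t * a⁻¹ := by group
  rw [w1, inv_mul_cancel, one_mul] at h
  have h2 := (hy.coef t).deg.act_act a b
  rw [inv_mul_cancel, one_mul, w2] at h2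
  rw [h2, map_smul, h, hy.coef_coef, map_smul, smul_smul, smul_smul, Units.val_mul, Units.val_mul]

theorem IsHomog.twist_isHomog (hx : IsHomog X s a x) : IsHomog X s a (TwistedDouble.twist X x) := by
  rw [hx.twist]
  convert (hx.coef s).act a using 1 <;> group

/-- Both sides are multiples of `(ab) T_{st,a} x ⊗ (ab) T_{tr,b} y`, where `s = a t r a⁻¹ t⁻¹`;
`balancing_aux` equates the scalars. -/
theorem IsHomog.twist₂_tmul (hx : IsHomog X s a x) (hy : IsHomog Y t b y) :
    twist₂ X Y (x ⊗ₜ y) = dbl X Y (TwistedDouble.twist X x ⊗ₜ TwistedDouble.twist Y y) := by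
  obtain ⟨r, rfl⟩ : ∃ r, s = a * t * r * a⁻¹ * t⁻¹ := ⟨t⁻¹ * a⁻¹ * s * t * a, by group⟩
  have e1 : twist₂ X Y (x ⊗ₜ y) = TwistedDouble.act (FDModule.tensor X.1 Y.1) (a * b)
      (coef₂ X Y (a * t * r * a⁻¹ * t⁻¹ * t) (a * b) (x ⊗ₜ y)) := (hx.tmul hy).twist
  have w1 : a * t * r * a⁻¹ * t⁻¹ * t = a * t * r * a⁻¹ := by group
  have w2 : a⁻¹ * (a * t * r * a⁻¹) * a = t * r := by group
  have e2 := act_tmul (hx.coef (a * t * r * a⁻¹)).deg (hy.coef (t * r)).deg (a * b)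
  have w3 : (a * t * r * a⁻¹)⁻¹ * (a * t * r * a⁻¹ * t⁻¹) * (t * r) = r := by group
  have w4 : (t * r)⁻¹ * t * (b⁻¹ * (t * r) * b) = r⁻¹ * b⁻¹ * t * r * b := by group
  rw [w2, w3, w4] at e2
  rw [e1, w1, hx.coef_tmul hy, w2]
  refine ((TwistedDouble.act (FDModule.tensor X.1 Y.1) (a * b)).map_smul _ _).trans ?_
  rw [e2]
  refine Eq.trans ?_ (hx.twist_isHomog.doubleBraiding_tmul hy.twist_isHomog).symm
  have w5 : a * b * a⁻¹ * ((a * t * a⁻¹)⁻¹ * (a * t * r * a⁻¹ * t⁻¹) * (a⁻¹ * (a * t * a⁻¹) * a)) *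
      (a * b * a⁻¹)⁻¹ = a * b * r * (a * b)⁻¹ := by group
  rw [w5, hx.twist, hy.twist, hx.act_coef_act_coef, hy.coef_act_act_coef, w1, w2, w3]
  have w6 : a⁻¹ * (a * t * r * a⁻¹ * t⁻¹) * a = t * r * a⁻¹ * t⁻¹ * a := by group
  rw [w6, ← TensorProduct.smul_tmul', TensorProduct.tmul_smul, smul_smul, ← Units.val_mul,
    ← ω.balancing_aux, Units.val_mul]
  exact smul_smul _ _ _

theorem linearMap_ext_of_homog_tmul {M : Type*} [AddCommGroup M] [Module k M]
    {f f' : X.1.V ⊗[k] Y.1.V →ₗ[k] M}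
    (h : ∀ s a x, IsHomog X s a x → ∀ t b y, IsHomog Y t b y → f (x ⊗ₜ y) = f' (x ⊗ₜ y)) :
    f = f' := by
  refine TensorProduct.ext (linearMap_ext_of_homog fun s a x hx => ?_)
  exact linearMap_ext_of_homog fun t b y hy => h s a x hx t b y hy

theorem twist₂_eq : twist₂ X Y = dbl X Y * TensorProduct.map (twist X) (twist Y) :=
  linearMap_ext_of_homog_tmul fun _ _ _ hx _ _ _ hy => hx.twist₂_tmul hy

/-- The double braiding is a morphism of the center, and the twist is natural. -/
theorem commute_dbl_twist₂ : Commute (dbl X Y) (twist₂ X Y) := by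
  refine LinearMap.ext fun z => ?_
  exact (twist_hom ((β_ X Y).hom ≫ (β_ Y X).hom) z).symm

theorem isUnit_dbl : IsUnit (dbl X Y) := by
  refine ⟨⟨dbl X Y, ((β_ Y X).inv ≫ (β_ X Y).inv).f.hom, ?_, ?_⟩, rfl⟩
  · have h : ((β_ Y X).inv ≫ (β_ X Y).inv) ≫ ((β_ X Y).hom ≫ (β_ Y X).hom) = 𝟙 (X ⊗ Y) := by simp
    exact congrArg (fun f => f.f.hom) h
  · have h : ((β_ X Y).hom ≫ (β_ Y X).hom) ≫ ((β_ Y X).inv ≫ (β_ X Y).inv) = 𝟙 (X ⊗ Y) := by simp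
    exact congrArg (fun f => f.f.hom) h

/-- Since `θ_{X ⊗ Y} = β² (θ_X ⊗ θ_Y)` commutes with the invertible `β²`, so does the second factor.
-/
theorem commute_dbl_map_twist :
    Commute (dbl X Y) (TensorProduct.map (twist X) (twist Y)) := by
  have h := commute_dbl_twist₂ (X := X) (Y := Y)
  rw [twist₂_eq, commute_iff_eq, mul_assoc] at h
  exact isUnit_dbl.mul_left_cancel h

theorem twist₂_pow (n : ℕ) : twist₂ X Y ^ n =
    dbl X Y ^ n * TensorProduct.map (twist X ^ n) (twist Y ^ n) := by
  rw [twist₂_eq, commute_dbl_map_twist.mul_pow, TensorProduct.map_pow]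

/-! ### Powers of the twist -/

/-- The twist is the product of this operator, which only affects `a`, and `rightTwist`. -/
noncomputable def leftTwist (X : Center (FDModule k (TwistedDouble ω))) (a : G) :
    Module.End k X.1.V := act X.1 a * coef X a a

/-- The operator `ω(p, a, a⁻¹pa) T_{p,a}`. -/
noncomputable def rightTwist (X : Center (FDModule k (TwistedDouble ω))) (p a : G) :
    Module.End k X.1.V := (ω p a (a⁻¹ * p * a) : k) • coef X p a

namespace IsHomog

variable {p : G}

theorem leftTwist (hx : IsHomog X s a x) : IsHomog X s a (leftTwist X a x) := by
  have h := (hx.coef a).act a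
  have w : a * (a⁻¹ * s * (a⁻¹ * a * a)) * a⁻¹ = s := by group
  rwa [w, mul_inv_cancel_right] at h

theorem rightTwist (hx : IsHomog X (p * a) a x) : IsHomog X (p * a) a (rightTwist X p a x) := by
  have h := (hx.coef p).smul (ω p a (a⁻¹ * p * a) : k)
  have w : p⁻¹ * (p * a) * (a⁻¹ * p * a) = p * a := by group
  rwa [w] at h

theorem leftTwist_rightTwist (hx : IsHomog X (p * a) a x) :
    TwistedDouble.leftTwist X a (TwistedDouble.rightTwist X p a x) = TwistedDouble.twist X x := by
  rw [TwistedDouble.rightTwist, LinearMap.smul_apply, map_smul, TwistedDouble.leftTwist,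
    Module.End.mul_apply, hx.coef_coef, map_smul, smul_smul, ← Units.val_mul, ω.hexScalar_twist,
    Units.val_one, one_smul, hx.twist]

/-- Moving `T_{p,a}` past the action of `a` conjugates `p`, and `hexScalar_comm` shows that the
resulting scalar is the one in the opposite order. -/
theorem rightTwist_leftTwist (hx : IsHomog X (p * a) a x) :
    TwistedDouble.rightTwist X p a (TwistedDouble.leftTwist X a x) = TwistedDouble.twist X x := by
  rw [← hx.leftTwist_rightTwist, TwistedDouble.rightTwist, LinearMap.smul_apply,
    LinearMap.smul_apply, map_smul]
  congr 1
  have h := coef_act (hx.coef a).deg a (a⁻¹ * p * a) a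
  have w1 : a * (a⁻¹ * p * a) * a⁻¹ = p := by group
  have w2 : a⁻¹ * (p * a) * (a⁻¹ * a * a) = a⁻¹ * (p * a) * a := by group
  have w3 : a * (a⁻¹ * p * a) = p * a := by group
  rw [w1, mul_inv_cancel_right, w2] at h
  rw [TwistedDouble.leftTwist, Module.End.mul_apply, Module.End.mul_apply, h, hx.coef_coef,
    hx.coef_coef, map_smul, map_smul, smul_smul, ← Units.val_mul, ω.hexScalar_comm, w3]

/-- Each step from `n` to `n + 1` contributes one factor of `π`, through `θ_a(a, a^n) = ω(a, a^n,
a)`. -/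
theorem leftTwist_pow (hx : IsHomog X s a x) (n : ℕ) :
    (TwistedDouble.leftTwist X a ^ n) x = (ω.piMap n a : k) •
      TwistedDouble.act X.1 (a ^ n) (TwistedDouble.coef X (a ^ n) a x) := by
  induction n with
  | zero => simp [NormalizedThreeCocycle.piMap, act_one, hx.coef_one]
  | succ n ih =>
    have hc : a * a ^ n = a ^ n * a := (pow_succ' a n).symm.trans (pow_succ a n)
    have e1 : a⁻¹ * a ^ n * a = a ^ n := by rw [mul_assoc, ← hc, inv_mul_cancel_left]
    have e2 : a ^ n * a * (a ^ n)⁻¹ = a := by rw [← hc, mul_inv_cancel_right]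
    have h := coef_act (hx.coef (a ^ n)).deg (a ^ n) a a
    rw [e1, e2] at h
    have w1 : a * a ^ n * ((a ^ n * a)⁻¹ * s * (a⁻¹ * (a ^ n * a) * a)) * (a * a ^ n)⁻¹ = s := by
      rw [hc]
      group
    rw [pow_succ', Module.End.mul_apply, ih, map_smul, TwistedDouble.leftTwist,
      Module.End.mul_apply, h, hx.coef_coef, map_smul, map_smul, map_smul,
      (hx.coef _).deg.act_act, smul_smul, smul_smul, smul_smul, w1, ω.piMap_succ, ← Units.val_mul,
      ← Units.val_mul, ← Units.val_mul, mul_assoc, mul_assoc, ← mul_assoc (ω.linScalar _ _ _ _),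
      ω.linScalar_mul_hexScalar s a (a ^ n) hc, pow_succ', ← hc, mul_comm (ω.piMap n a)]
    congr 3
    have w2 : (a * a ^ n)⁻¹ * a * (a * a ^ n) = a := by
      rw [hc, mul_inv_rev, mul_assoc, mul_assoc, ← mul_assoc a, hc, mul_assoc (a ^ n),
        inv_mul_cancel_left, inv_mul_cancel_left]
    -- Since `a` commutes with its powers, two of the three factors of `θ_a(a, a^n)` cancel, leaving
    -- `ω(a, a^n, a)`.
    rw [NormalizedThreeCocycle.θ, w2, inv_mul_cancel, one_mul, mul_div_cancel_left]

/-- The induction step is `powScalar_mul` at `h = p^n`; its leftover `ω(p, p^n, p)` puts `π_n(p)` in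
the denominator. -/
theorem rightTwist_pow (hx : IsHomog X (p * a) a x) (n : ℕ) :
    (TwistedDouble.rightTwist X p a ^ n) x =
      ((ω.powScalar p a (p ^ n) / ω.piMap n p : kˣ) : k) • TwistedDouble.coef X (p ^ n) a x := by
  induction n with
  | zero => simp [NormalizedThreeCocycle.piMap, hx.coef_one, ω.powScalar_one]
  | succ n ih =>
    have hc : p * p ^ n = p ^ n * p := (pow_succ' p n).symm.trans (pow_succ p n)
    rw [pow_succ', Module.End.mul_apply, ih, map_smul, TwistedDouble.rightTwist,
      LinearMap.smul_apply, hx.coef_coef, smul_smul, smul_smul, ← Units.val_mul, ← Units.val_mul,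
      pow_succ, ω.piMap_succ, ← ω.powScalar_mul p a _ hc, ω.powScalar_self]
    congr 2
    apply Additive.ofMul.injective
    simp only [ofMul_mul, ofMul_div]
    abel

/-- Both operators preserve degree `pa` and label `a`, so they commute along the whole orbit of `x`
and the power of their product splits. -/
theorem twist_pow (hx : IsHomog X (p * a) a x) (n : ℕ) :
    (TwistedDouble.twist X ^ n) x =
      (TwistedDouble.leftTwist X a ^ n) ((TwistedDouble.rightTwist X p a ^ n) x) := by
  have hR : ∀ n, IsHomog X (p * a) a ((TwistedDouble.rightTwist X p a ^ n) x) := by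
    intro n
    induction n with
    | zero => simpa using hx
    | succ n ih =>
      rw [pow_succ', Module.End.mul_apply]
      exact ih.rightTwist
  have hL : ∀ (n : ℕ) (z : X.1.V), IsHomog X (p * a) a z →
      TwistedDouble.twist X ((TwistedDouble.leftTwist X a ^ n) z) =
        (TwistedDouble.leftTwist X a ^ (n + 1)) (TwistedDouble.rightTwist X p a z) := by
    intro n
    induction n with
    | zero => intro z hz; simp [hz.leftTwist_rightTwist]
    | succ n ih =>
      intro z hz
      rw [pow_succ, Module.End.mul_apply, ih _ hz.leftTwist, hz.rightTwist_leftTwist,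
        ← hz.leftTwist_rightTwist, ← Module.End.mul_apply, ← pow_succ]
  induction n with
  | zero => simp
  | succ n ih =>
    rw [pow_succ', Module.End.mul_apply, ih, hL _ _ (hR n), pow_succ' (TwistedDouble.rightTwist X p a),
      Module.End.mul_apply]

/-- Once `a^n = p^n = 1`, the remaining operators are the action of `1` and `T_{1,a}`, which fix
`x`; only the scalars from the two powers remain. -/
theorem twist_pow_of_pow_eq_one (hx : IsHomog X s a x) {n : ℕ} (hn : ∀ g : G, g ^ n = 1) :
    (TwistedDouble.twist X ^ n) x = ((ω.piMap n a / ω.piMap n (s * a⁻¹) : kˣ) : k) • x := by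
  obtain ⟨p, rfl⟩ : ∃ p, s = p * a := ⟨s * a⁻¹, by group⟩
  rw [hx.twist_pow, hx.rightTwist_pow, map_smul, hn, hx.coef_one, hx.leftTwist_pow, hn, act_one,
    hx.coef_one, smul_smul, ω.powScalar_one, mul_inv_cancel_right, ← Units.val_mul]
  congr 2
  apply Additive.ofMul.injective
  simp only [ofMul_mul, ofMul_div, ofMul_one]
  abel

theorem dbl_pow_tmul (hx : IsHomog X s a x) (hy : IsHomog Y t b y) {n : ℕ}
    (hn : ∀ g : G, g ^ n = 1) : (dbl X Y ^ n) (x ⊗ₜ y) =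
      ((ω.piMap n (a * b) / ω.piMap n (s * t * (a * b)⁻¹) /
        (ω.piMap n a / ω.piMap n (s * a⁻¹) * (ω.piMap n b / ω.piMap n (t * b⁻¹))) : kˣ) : k) •
          (x ⊗ₜ[k] y) := by
  have h1 := (hx.tmul hy).twist_pow_of_pow_eq_one hn
  change (twist₂ X Y ^ n) (x ⊗ₜ y) = _ at h1
  rw [twist₂_pow, Module.End.mul_apply, TensorProduct.map_tmul, hx.twist_pow_of_pow_eq_one hn,
    hy.twist_pow_of_pow_eq_one hn, TensorProduct.smul_tmul_smul, map_smul, ← Units.val_mul] at h1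
  exact eq_smul_of_smul_eq h1

end IsHomog

/-- The double braidings of the center have order dividing `n` if `π_{n,ω}` is a character. -/
theorem dbl_pow_eq_one (X Y : Center (FDModule k (TwistedDouble ω))) {n : ℕ}
    (hn : ∀ g : G, g ^ n = 1) (χ : G →* kˣ) (hχ : ∀ g, χ g = ω.piMap n g) : dbl X Y ^ n = 1 := by
  refine linearMap_ext_of_homog_tmul fun s a x hx t b y hy => ?_
  rw [hx.dbl_pow_tmul hy hn]
  simp only [← hχ, map_mul, map_inv, Module.End.one_apply]
  -- The target of `χ` is abelian, so the scalars of the tensor product cancel those of its factors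
  -- despite the order in `(ab)⁻¹`.
  convert one_smul k _
  rw [Units.val_eq_one]
  apply Additive.ofMul.injective
  simp only [ofMul_mul, ofMul_div, ofMul_inv, ofMul_one]
  abel

end TwistedDouble

namespace TwistedDouble

open FDModule

variable {G : Type v} {k : Type u} [Group G] [Field k] {ω : NormalizedThreeCocycle G k}
  [Fintype G] [DecidableEq G] {U V W : FDModule k (TwistedDouble ω)} {s t : G}

/-! ### The braiding of representations of `D^ω G` -/

theorem act_surjective (w : G) : Function.Surjective (act V w) := by
  rw [← LinearMap.range_eq_top, eq_top_iff]
  intro v _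
  rw [← sum_ρ_e_one v]
  refine Submodule.sum_mem _ fun g _ => ?_
  set z := V.ρ (e ω g 1) v
  have hz : IsDeg V g z := isDeg_ρ_e g 1 v
  have h := hz.act_act w w⁻¹
  rw [mul_inv_cancel, act_one] at h
  refine ⟨(((ω.θ (1 * g * 1⁻¹) w w⁻¹)⁻¹ : kˣ) : k) • act V w⁻¹ z, ?_⟩
  rw [map_smul, h, smul_smul, ← Units.val_mul, inv_mul_cancel, Units.val_one, one_smul]

/-- The braiding `v ⊗ w ↦ s w ⊗ v` for `v` of degree `s`. -/
noncomputable def braid (V W : FDModule k (TwistedDouble ω)) :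
    V.V ⊗[k] W.V →ₗ[k] W.V ⊗[k] V.V :=
  ∑ s, TensorProduct.map (act W s) (V.ρ (e ω s 1)) ∘ₗ (TensorProduct.comm k V.V W.V).toLinearMap

theorem IsDeg.braid_tmul {v : V.V} (hv : IsDeg V s v) (w : W.V) :
    braid V W (v ⊗ₜ w) = TwistedDouble.act W s w ⊗ₜ v := by
  simp only [braid, LinearMap.sum_apply, LinearMap.comp_apply, LinearEquiv.coe_coe,
    TensorProduct.comm_tmul, TensorProduct.map_tmul, hv.ρ_e_one]
  rw [Finset.sum_eq_single s]
  · rw [if_pos rfl]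
  · intro t _ ht
    rw [if_neg ht, TensorProduct.tmul_zero]
  · simp

/-- Both tensor products have the same dimension, so this is enough for the braiding to be an
isomorphism. -/
theorem braid_surjective : Function.Surjective (braid V W) := by
  rw [← LinearMap.range_eq_top, eq_top_iff]
  intro z _
  induction z with
  | zero => exact Submodule.zero_mem _
  | add x y hx hy => exact Submodule.add_mem _ (hx trivial) (hy trivial)
  | tmul w v =>
    rw [← sum_ρ_e_one v, TensorProduct.tmul_sum]
    refine Submodule.sum_mem _ fun s _ => ?_
    obtain ⟨w', rfl⟩ := act_surjective s w
    exact ⟨_, (isDeg_ρ_e s 1 v).braid_tmul w'⟩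

theorem linearMap_ext_of_deg_tmul {M : Type*} [AddCommGroup M] [Module k M]
    {f f' : V.V ⊗[k] W.V →ₗ[k] M}
    (h : ∀ s v, IsDeg V s v → ∀ t w, IsDeg W t w → f (v ⊗ₜ w) = f' (v ⊗ₜ w)) : f = f' := by
  refine TensorProduct.ext (linearMap_ext_of_deg fun s v hv => ?_)
  exact linearMap_ext_of_deg fun t w hw => h s v hv t w hw

/-- On homogeneous vectors the two scalars are the numerator and denominator of a `linScalar` with
degree equal to label, so `linScalar_of_diag` applies. -/
theorem braid_comul (h : TwistedDouble ω) (z : V.V ⊗[k] W.V) :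
    braid V W (tensorAct V.ρ W.ρ (comul ω h) z) = tensorAct W.ρ V.ρ (comul ω h) (braid V W z) := by
  induction h using induct with
  | h0 => simp
  | hadd a a' h h' => simp only [map_add, LinearMap.add_apply, h, h']
  | hsmul r a h => simp only [map_smul, LinearMap.smul_apply, h]
  | he g w =>
    have key : braid V W ∘ₗ tensorAct V.ρ W.ρ (comul ω (e ω g w)) =
        tensorAct W.ρ V.ρ (comul ω (e ω g w)) ∘ₗ braid V W := by
      refine linearMap_ext_of_deg_tmul fun s x hx t y hy => ?_
      have w1 : w * (s * t * s⁻¹) * s * w⁻¹ = w * s * t * w⁻¹ := by group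
      rw [LinearMap.comp_apply, LinearMap.comp_apply, hx.braid_tmul, tensorAct_comul_e hx hy,
        tensorAct_comul_e (hy.act s) hx, w1]
      split_ifs
      · have w2 : w * s * w⁻¹ * w * t * (w * s * w⁻¹ * w)⁻¹ = w * (s * t * s⁻¹) * w⁻¹ := by group
        have w3 : w * s * t * (w * s)⁻¹ = w * (s * t * s⁻¹) * w⁻¹ := by group
        rw [map_smul, (hx.act w).braid_tmul, hy.act_act, hy.act_act, ← TensorProduct.smul_tmul',
          ← TensorProduct.smul_tmul', smul_smul, smul_smul, w2, w3, inv_mul_cancel_right,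
          ← Units.val_mul, ← Units.val_mul]
        congr 2
        have h := ω.linScalar_of_diag w (s * t * s⁻¹) s
        rw [NormalizedThreeCocycle.linScalar, div_eq_one] at h
        have w4 : s⁻¹ * (s * t * s⁻¹) * s = t := by group
        have w5 : (s * t * s⁻¹)⁻¹ * s * t = s := by group
        rw [w4, w5] at h
        exact h.symm
      · exact map_zero _
    exact LinearMap.congr_fun key z

/-- The braiding with a tensor product. -/
noncomputable def braid₂ (U V W : FDModule k (TwistedDouble ω)) :
    U.V ⊗[k] (V.V ⊗[k] W.V) →ₗ[k] (V.V ⊗[k] W.V) ⊗[k] U.V := braid U (tensor V W)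

/-- On homogeneous vectors this is the definition of `γ`: its three factors of `ω` are the three
reassociations. -/
theorem braid_hexagon (z : (U.V ⊗[k] V.V) ⊗[k] W.V) :
    associatorEquiv V W U (braid₂ U V W (associatorEquiv U V W z)) =
      TensorProduct.map LinearMap.id (braid U W) (associatorEquiv V U W
        (TensorProduct.map (braid U V) LinearMap.id z)) := by
  have key : (associatorEquiv V W U).toLinearMap ∘ₗ braid₂ U V W ∘ₗ
      (associatorEquiv U V W).toLinearMap =
      TensorProduct.map LinearMap.id (braid U W) ∘ₗ (associatorEquiv V U W).toLinearMap ∘ₗ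
        TensorProduct.map (braid U V) LinearMap.id := by
    refine TensorProduct.ext (linearMap_ext_of_deg_tmul fun a x hx g y hy => ?_)
    refine linearMap_ext_of_deg fun m z hz => ?_
    change associatorEquiv V W U (braid₂ U V W (associatorEquiv U V W ((x ⊗ₜ y) ⊗ₜ z))) =
      TensorProduct.map LinearMap.id (braid U W) (associatorEquiv V U W
        (TensorProduct.map (braid U V) LinearMap.id ((x ⊗ₜ y) ⊗ₜ z)))
    have e1 : braid₂ U V W (x ⊗ₜ (y ⊗ₜ z)) = (ω.γ a (a * g * a⁻¹) (a * m * a⁻¹) : k) •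
          ((act V a y ⊗ₜ[k] act W a z) ⊗ₜ[k] x) :=
      (hx.braid_tmul _).trans (congrArg (· ⊗ₜ[k] x) (act_tmul hy hz a))
    rw [associatorEquiv_tmul hx hy hz, map_smul, e1, map_smul, map_smul,
      associatorEquiv_tmul (hy.act a) (hz.act a) hx, TensorProduct.map_tmul, hx.braid_tmul,
      LinearMap.id_apply, associatorEquiv_tmul (hy.act a) hx hz, map_smul, TensorProduct.map_tmul,
      hx.braid_tmul, LinearMap.id_apply, smul_smul, smul_smul, ← Units.val_mul, ← Units.val_mul]
    congr 2
    have w1 : a⁻¹ * (a * g * a⁻¹) * a = g := by group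
    have w2 : a⁻¹ * (a * m * a⁻¹) * a = m := by group
    rw [NormalizedThreeCocycle.γ, w1, w2]
    apply Additive.ofMul.injective
    simp only [ofMul_mul, ofMul_div, ofMul_inv]
    abel
  exact LinearMap.congr_fun key z

/-- The half-braiding given by the braiding of representations. -/
noncomputable def braidIso (V W : FDModule k (TwistedDouble ω)) : V ⊗ W ≅ W ⊗ V :=
  mkIso (X := tensor V W) (Y := tensor W V) (LinearEquiv.ofBijective (braid V W)
    ⟨(LinearMap.injective_iff_surjective_of_finrank_eq_finrank
      (by rw [Module.finrank_tensorProduct, Module.finrank_tensorProduct, mul_comm])).mpr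
        braid_surjective, braid_surjective⟩) braid_comul

/-- A representation of `D^ω G` as an object of the center, through the braiding. -/
noncomputable def ofRep (V : FDModule k (TwistedDouble ω)) : Center (FDModule k (TwistedDouble ω)) :=
  ⟨V, {
    β := braidIso V
    monoidal := fun U U' => by
      rw [← cancel_epi (α_ V U U').hom, ← cancel_mono (α_ U U' V).hom]
      simp only [Category.assoc, Iso.hom_inv_id_assoc, Iso.inv_hom_id, Category.comp_id]
      exact hom_ext (LinearMap.ext braid_hexagon)
    naturality := fun {U U'} f => by
      refine hom_ext (linearMap_ext_of_deg_tmul (V := V) (W := U) fun s x hx t y hy => ?_)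
      refine (hx.braid_tmul _).trans ?_
      refine Eq.trans ?_ (congrArg (TensorProduct.map f.hom LinearMap.id) (hx.braid_tmul y)).symm
      exact congrArg (· ⊗ₜ[k] x) (f.comm _ y).symm }⟩

theorem IsDeg.isHomog_ofRep {v : V.V} (hv : IsDeg V s v) : IsHomog (ofRep V) s s v := by
  refine ⟨hv, ?_⟩
  have h := (halfBraid_of_deg (X := ofRep V) (isDeg_regE (ω := ω) 1) v).symm.trans
    (hv.braid_tmul (regE (ω := ω) 1))
  have h' := eq_ite_of_sum_act_regE_tmul (M := V.V)
    (z := fun c => TwistedDouble.coef (ofRep V) (c * 1 * c⁻¹) c v) h s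
  simp only [mul_one, mul_inv_cancel, if_true] at h'
  exact h'

/-- The double braiding of two representations. -/
noncomputable def braidSq (V W : FDModule k (TwistedDouble ω)) : Module.End k (V.V ⊗[k] W.V) :=
  braid W V ∘ₗ braid V W

/-- For `y` of degree `1` the return braiding acts trivially on `x`, and `θ_1 = 1` makes the
repeated action of `s` on `y` an honest one. -/
theorem braidSq_pow_tmul {x : V.V} {y : W.V} (hx : IsDeg V s x) (hy : IsDeg W 1 y) (n : ℕ) :
    (braidSq V W ^ n) (x ⊗ₜ y) = x ⊗ₜ[k] act W (s ^ n) y := by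
  induction n with
  | zero => rw [pow_zero, pow_zero, act_one, Module.End.one_apply]
  | succ n ih =>
    have h1 : IsDeg W 1 (act W (s ^ n) y) := by simpa using hy.act (s ^ n)
    have h2 : IsDeg W 1 (act W s (act W (s ^ n) y)) := by simpa using h1.act s
    have h3 := hy.act_act s (s ^ n)
    have h4 : ω.θ 1 s (s ^ n) = 1 := by
      simp [NormalizedThreeCocycle.θ, ω.map_one_left, ω.map_one_mid, ω.map_one_right]
    rw [mul_one, mul_inv_cancel, ← pow_succ', h4, Units.val_one, one_smul] at h3
    rw [pow_succ' (braidSq V W), Module.End.mul_apply, ih, braidSq, LinearMap.comp_apply,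
      hx.braid_tmul, h2.braid_tmul, act_one, h3]

/-- The coordinate of `e_g # 1` on the regular representation. -/
noncomputable def regCoord (ω : NormalizedThreeCocycle G k) (g : G) :
    (regular k (TwistedDouble ω)).V →ₗ[k] k :=
  (basis ω).coord (g, 1) ∘ₗ (regularEquiv k (TwistedDouble ω)).toLinearMap

theorem regCoord_regE (g : G) : regCoord ω g (regE g) = 1 := by
  simp [regCoord, regE, e]

/-- Applied to `e_g ⊗ e_1`, the `n`-th power of the double braiding gives `e_g ⊗ (e_1 # g^n)`, which
must be `e_g ⊗ (e_1 # 1)`. -/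
theorem pow_eq_one_of_braidSq_pow {n : ℕ}
    (h : braidSq (regular k (TwistedDouble ω)) (regular k (TwistedDouble ω)) ^ n = 1)
    (g : G) : g ^ n = 1 := by
  have h1 := braidSq_pow_tmul (isDeg_regE (ω := ω) g) (isDeg_regE (ω := ω) 1) n
  rw [h, Module.End.one_apply] at h1
  have h2 := congrArg (fun z => TensorProduct.lid k (TwistedDouble ω)
    (TensorProduct.map (regCoord ω g) (regularEquiv k (TwistedDouble ω)).toLinearMap z)) h1
  simp only [TensorProduct.map_tmul, regCoord_regE, TensorProduct.lid_tmul, one_smul,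
    LinearEquiv.coe_coe, regularEquiv_act_regE] at h2
  rw [regE, LinearEquiv.apply_symm_apply] at h2
  exact (congrArg Prod.snd ((basis ω).injective h2)).symm

/-- For a representation label equals degree, so the factors `π_n(sa⁻¹)` are trivial and the scalar
on `e_g ⊗ e_h` is the failure of multiplicativity of `π_n`. -/
theorem piMap_mul_of_braidSq_pow {n : ℕ}
    (hn : braidSq (regular k (TwistedDouble ω)) (regular k (TwistedDouble ω)) ^ n = 1)
    (g h : G) : ω.piMap n (g * h) = ω.piMap n g * ω.piMap n h := by
  have h1 := (isDeg_regE (ω := ω) g).isHomog_ofRep.dbl_pow_tmul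
    (isDeg_regE (ω := ω) h).isHomog_ofRep (pow_eq_one_of_braidSq_pow hn)
  simp only [mul_inv_cancel, ω.piMap_one_right, div_one] at h1
  have h2 : (braidSq _ _ ^ n) (regE (ω := ω) g ⊗ₜ[k] regE (ω := ω) h) =
    ((ω.piMap n (g * h) / (ω.piMap n g * ω.piMap n h) : kˣ) : k) •
      (regE (ω := ω) g ⊗ₜ[k] regE (ω := ω) h) := h1
  rw [hn, Module.End.one_apply] at h2
  have h3 := congrArg (fun z => TensorProduct.lid k k
    (TensorProduct.map (regCoord ω g) (regCoord ω h) z)) h2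
  simp only [map_smul, TensorProduct.map_tmul, regCoord_regE, TensorProduct.lid_tmul, one_smul,
    smul_eq_mul, mul_one] at h3
  exact div_eq_one.mp (Units.val_eq_one.mp h3.symm)

end TwistedDouble

/-! ### Unipotence, finite order and the exponent -/

/-- Over a field of characteristic zero, an operator of finite order that is unipotent is
trivial. -/
theorem Module.End.eq_one_of_pow_eq_one_of_isNilpotent_sub_one {K M : Type*} [Field K] [CharZero K]
    [AddCommGroup M] [Module K M] [FiniteDimensional K M] {f : Module.End K M} {n : ℕ} (hn : 0 < n)
    (h : f ^ n = 1) (hf : IsNilpotent (f - 1)) : f = 1 := by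
  -- In characteristic zero `X^n - 1` is separable, so an operator of finite order is semisimple.
  have h1 : f.IsSemisimple := by
    refine Module.End.isSemisimple_of_squarefree_aeval_eq_zero
      (Polynomial.X_pow_sub_one_separable_iff.mpr (Nat.cast_ne_zero.mpr hn.ne')).squarefree ?_
    simp [h]
  have h2 : (f - 1).IsSemisimple := by
    simpa using Module.End.isSemisimple_sub_algebraMap_iff (μ := (1 : K)) |>.mpr h1
  exact sub_eq_zero.mp (Module.End.eq_zero_of_isNilpotent_isSemisimple hf h2)

namespace TwistedDouble

variable {G : Type v} {k : Type u} [Group G] [Field k] (ω : NormalizedThreeCocycle G k)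

/-- The witness is `|G|²`: one factor `|G|` gives `g^{|G|} = 1`, and the other raises `π_{|G|}(g)`
to the power `|G|`, which kills it. -/
theorem exists_pos_piMap_eq_one [Fintype G] :
    ∃ n : ℕ, 0 < n ∧ (∀ g : G, g ^ n = 1) ∧ ∀ g : G, ω.piMap n g = 1 := by
  have hg : ∀ g : G, g ^ Fintype.card G = 1 := fun g => pow_card_eq_one
  refine ⟨Fintype.card G * Fintype.card G, mul_pos Fintype.card_pos Fintype.card_pos,
    fun g => by rw [pow_mul, hg], fun g => ?_⟩
  rw [ω.piMap_mul _ (hg g), ω.piMap_pow_card (hg g)]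

/-- Unipotent powers of the squared braiding of the center of `Rep D^ω G` are detected by
`π_{n,ω}`. -/
theorem isNilpotent_doubleBraiding_pow_sub_one_iff [CharZero k] [Fintype G] [DecidableEq G]
    (n : ℕ) :
    (∀ X Y : Center (FDModule k (TwistedDouble ω)), IsNilpotent (doubleBraiding X Y ^ n - 1)) ↔
      (∃ χ : G →* kˣ, ∀ g : G, χ g = ω.piMap n g) ∧ ∀ g : G, g ^ n = 1 := by
  constructor
  · intro h
    obtain ⟨m, hm, hpow, hpi⟩ := exists_pos_piMap_eq_one ω
    set R := FDModule.regular k (TwistedDouble ω)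
    -- Here `π_m = 1` is the trivial character, so the sufficient condition already gives the double
    -- braiding finite order.
    have h1 : braidSq R R ^ m = 1 :=
      dbl_pow_eq_one (ofRep R) (ofRep R) hpow 1 fun g => (hpi g).symm
    have h2 : braidSq R R ^ n = 1 :=
      Module.End.eq_one_of_pow_eq_one_of_isNilpotent_sub_one hm
        (by rw [← pow_mul, mul_comm, pow_mul, h1, one_pow]) (h (ofRep R) (ofRep R))
    exact ⟨⟨⟨⟨ω.piMap n, ω.piMap_one_right n⟩, piMap_mul_of_braidSq_pow h2⟩, fun g => rfl⟩,
      pow_eq_one_of_braidSq_pow h2⟩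
  · rintro ⟨⟨χ, hχ⟩, hn⟩ X Y
    have h1 : doubleBraiding X Y ^ n = 1 := dbl_pow_eq_one X Y hn χ hχ
    rw [h1, sub_self]
    exact IsNilpotent.zero

end TwistedDouble

/-- Let `k` be algebraically closed of characteristic zero, `G` a finite group and `ω` a normalized
3-cocycle on `G`. The exponent of `G` divides the exponent of `D^ω G`, and the latter is the least
`n ≥ 1` such that `π_{n,ω}` is a character of `G` and `g ^ n = 1` for all `g`. -/
theorem mainTheorem4 {k : Type u} [Field k] [IsAlgClosed k] [CharZero k]
    {G : Type v} [Group G] [Fintype G] [DecidableEq G] (ω : NormalizedThreeCocycle G k) :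
    Monoid.exponent G ∣ quasiExponent k (TwistedDouble ω) ∧
      IsLeast {n : ℕ | 0 < n ∧ (∃ χ : G →* kˣ, ∀ g : G, χ g = ω.piMap n g) ∧
        ∀ g : G, g ^ n = 1} (quasiExponent k (TwistedDouble ω)) := by
  have h : IsLeast {n : ℕ | 0 < n ∧ (∃ χ : G →* kˣ, ∀ g : G, χ g = ω.piMap n g) ∧
      ∀ g : G, g ^ n = 1} (quasiExponent k (TwistedDouble ω)) := by
    simp only [quasiExponent, TwistedDouble.isNilpotent_doubleBraiding_pow_sub_one_iff]
    -- An element of the set is needed, since `sInf` of the empty set is `0`.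
    obtain ⟨m, hm, hpow, hpi⟩ := TwistedDouble.exists_pos_piMap_eq_one ω
    exact ⟨Nat.sInf_mem ⟨m, hm, ⟨1, fun g => (hpi g).symm⟩, hpow⟩, fun n hn => Nat.sInf_le hn⟩
  exact ⟨Monoid.exponent_dvd_of_forall_pow_eq_one h.1.2.2, h⟩
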